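/- Setting. Work in a vertical plane with coordinates $(x,y)$. Let $h,r,L>0$ with $h>2r$, let $T$ be a point above the line $y=h$, and let $r_{top}$ be the take-off line $y=h-r$. The aerial obstacles are $n\ge 0$ isothetic rectangles whose bases are not below the line $y=h$ and that lie in the closed half-plane to the left of the vertical line through $T$. A segment or chain collides with an obstacle if it meets the interior of the rectangle (touching the boundary is allowed); only aerial obstacles are considered for collisions. Let $T'$ be the orthogonal projection of $T$ onto $r_{top}$, and let $Q\in r_{top}$ be the point, not to the right of $T'$, at distance exactly $L$ from $T$ (so $L\ge |TT'|$). A CICP from $Y$ to $T$ is a polygonal chain $v_0=Y,v_1,\dots,v_k=T$ that is collision-free, increasing (each $v_i\ne v_{i-1}$ lies in the closed quadrant to the right of and above $v_{i-1}$) and convex (each $v_i$, $0<i<k$, lies to the right of or on the directed line from $v_{i-1}$ to $v_{i+1}$). A point $Y$ is $L$-polygonal-visible if there is a CICP from $Y$ to $T$ of length at most $L$. Algorithm PVA-2D. Let $u_i$ and $l_i$ be the upper-left and lower-right vertices of the $i$-th obstacle, indexed so that the heights of $l_1,\dots,l_n$ are non-increasing, and let $l_0=T$. Ties (equal heights in this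 order, or equal minima in STEP 1) are resolved by order of appearance. STEP 1. Put $\mathcal P_{alg}(l_0)=\langle T\rangle$ and $\mathcal L[0]=0$. For $j=1,\dots,n$ in turn, let $I_j$ be the set of $i<j$ for which $\mathcal P_{alg}(l_i)$ exists and $\overline{l_jl_i}\cup\mathcal P_{alg}(l_i)$ is a CICP. If $I_j\neq\emptyset$, set $\mathcal L[j]=\min_{i\in I_j}\{\mathcal L[i]+\|l_i-l_j\|_2\}$ and $\mathcal P_{alg}(l_j)=\overline{l_jl_i}\cup\mathcal P_{alg}(l_i)$ for a minimizing $i$; otherwise $\mathcal P_{alg}(l_j)$ does not exist and $\mathcal L[j]=\infty$. STEP 2. For each $u_i$, among the $l_j$ ($0\le j\le n$) such that $\overline{u_il_j}\cup\mathcal P_{alg}(l_j)$ is a CICP, let $l^*_j$ be one for which $\overline{u_il_j}$ has maximum slope, if there is any, and let $A_i$ be the intersection point of $r_{top}$ with the line through $u_i$ and $l_j^*$, if it exists. $A_i$ is a left end-point if $\|A_i-l_j^*\|_2+\mathcal L[j]\le L$ and $\overline{A_il_j^*}$ does not collide with any obstacle. STEP 3. For each $j$ with $\mathcal L[j]<\infty$,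 let $B_j\in r_{top}$ be the point not to the right of $l_j$ with $\|B_j-l_j\|_2=L-\mathcal L[j]$, if it exists. $B_j$ is a right end-point if $\overline{B_jl_j}\cup\mathcal P_{alg}(l_j)$ is a CICP and there is no $k\in\{0,\dots,n\}$ such that $\overline{B_jl_k}\cup\mathcal P_{alg}(l_k)$ is a CICP of length less than $L$. STEP 4. Let $\mathcal H$ be the collection of all left and right end-points, ordered from left to right. The set $\mathcal I$ consists of the intervals $(A_i,B_j)$ of $r_{top}$ such that $A_i$ is a left end-point, $B_j$ is a right end-point to the right of $A_i$, and no point of $\mathcal H$ lies strictly between them; and of the interval $[Q,B_j)$ if $B_j$ is a right end-point and no point of $\mathcal H$ lies strictly to the left of $B_j$. The output is the complement of the union of the intervals of $\mathcal I$ within $[Q,T']$. Theorem. Let $Y$ be a point of the interval $[Q,T']$ of $r_{top}$. Then $Y$ is not $L$-polygonal-visible if and only if $Y$ belongs to an interval in $\mathcal I$. Consequently, the output of PVA-2D is exactly the set of $L$-polygonal-visible points of $[Q,T']$. -/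

import Mathlib

noncomputable section

namespace PVA

/-- Points of the vertical plane: `p 0` is the abscissa and `p 1` is the height. -/
abbrev Point := EuclideanSpace ℝ (Fin 2)

/-- A (nondegenerate) isothetic rectangle `[left, right] × [bot, top]`. -/
structure Rect where
  left : ℝ
  right : ℝ
  bot : ℝ
  top : ℝ
  left_lt_right : left < right
  bot_lt_top : bot < top

namespace Rect

/-- The upper-left vertex `u` of a rectangle. -/
def upperLeft (R : Rect) : Point := !₂[R.left, R.top]

/-- The lower-right vertex `l` of a rectangle. -/
def lowerRight (R : Rect) : Point := !₂[R.right, R.bot]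

/-- The open rectangle. Touching the boundary of an obstacle is not a collision. -/
def inside (R : Rect) : Set Point :=
  {p | R.left < p 0 ∧ p 0 < R.right ∧ R.bot < p 1 ∧ p 1 < R.top}

end Rect

/-! ### Collision-free increasing convex polygonal chains -/

/-- The region to the right of and above `p`: the closed quadrant with corner `p`, so that
vertical and horizontal edges are allowed, but without `p` itself, so that consecutive vertices
of an increasing chain are distinct. -/
def NE (p : Point) : Set Point := {q | p 0 ≤ q 0 ∧ p 1 ≤ q 1 ∧ q ≠ p}

/-- `q` lies to the right of, or on, the directed line from `p` to `r`. -/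
def RightOrOn (p q r : Point) : Prop :=
  (r 0 - p 0) * (q 1 - p 1) - (r 1 - p 1) * (q 0 - p 0) ≤ 0

/-- The segment `pq` does not cross any obstacle. -/
def SegFree (obs : List Rect) (p q : Point) : Prop :=
  ∀ R ∈ obs, Disjoint (segment ℝ p q) R.inside

/-- Every vertex of the chain lies in the `NE` region of the preceding one. -/
def Increasing : List Point → Prop
  | p :: q :: c => q ∈ NE p ∧ Increasing (q :: c)
  | _ => True

/-- Every vertex of the chain other than its two ends is a convex vertex. -/
def ConvexChain : List Point → Prop
  | p :: q :: r :: c => RightOrOn p q r ∧ ConvexChain (q :: r :: c)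
  | _ => True

/-- No edge of the chain crosses an obstacle. -/
def CollisionFree (obs : List Rect) : List Point → Prop
  | p :: q :: c => SegFree obs p q ∧ CollisionFree obs (q :: c)
  | _ => True

/-- The length of a polygonal chain. -/
def chainLength : List Point → ℝ
  | p :: q :: c => dist p q + chainLength (q :: c)
  | _ => 0

/-- `c` is the list of vertices of a CICP from `Y` to `T`. -/
structure IsCICP (obs : List Rect) (T Y : Point) (c : List Point) : Prop where
  head : c.head? = some Y
  last : c.getLast? = some T
  collisionFree : CollisionFree obs c
  increasing : Increasing c
  convex : ConvexChain c

/-- `Y` is `L`-polygonal-visible. -/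
def PVisible (obs : List Rect) (T : Point) (L : ℝ) (Y : Point) : Prop :=
  ∃ c, IsCICP obs T Y c ∧ chainLength c ≤ L

/-! ### STEP 1 -/

/-- What the algorithm stores for a vertex `l_j` for which `P_alg(l_j)` exists: the vertex, the
chain `P_alg(l_j)`, and the value `𝓛[j]`. (The hook `𝓓[j]` is the second vertex of the chain.) -/
structure Entry where
  vertex : Point
  chain : List Point
  len : ℝ

open Classical in
/-- The entries `l_i` computed so far such that the segment from `p` to `l_i` followed by
`P_alg(l_i)` is a CICP. -/
def candidates (obs : List Rect) (T p : Point) (tab : List Entry) : List Entry :=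
  tab.filter fun e => decide (IsCICP obs T p (p :: e.chain))

/-- Treat one lower-right vertex `l`: among the candidates `l_i` choose one that minimizes
`𝓛[i] + ‖l_i - l‖`, and append the entry of `l`. Without candidates `P_alg(l)` does not exist
(`𝓛 = ∞`), and the table is unchanged. -/
def update (obs : List Rect) (T : Point) (tab : List Entry) (l : Point) : List Entry :=
  match (candidates obs T l tab).argmin (fun e => e.len + dist e.vertex l) with
  | none => tab
  | some e => tab ++ [⟨l, l :: e.chain, e.len + dist e.vertex l⟩]

/-- The lower-right vertices `l_1, …, l_n`, arranged in decreasing order of height. -/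
def sortedLowerRight (obs : List Rect) : List Point :=
  (obs.map Rect.lowerRight).mergeSort fun p q => decide (q 1 ≤ p 1)

/-- The result of STEP 1: start with `l_0 = T`, then treat `l_1, …, l_n` in this order. -/
def table (obs : List Rect) (T : Point) : List Entry :=
  (sortedLowerRight obs).foldl (update obs T) [⟨T, [T], 0⟩]

/-! ### STEP 2 -/

/-- The slope of the line through two points (used only for points with distinct abscissas). -/
def slopeOf (p q : Point) : ℝ := (q 1 - p 1) / (q 0 - p 0)

/-- `e` is a choice of `l*_j` for the upper-left vertex `u`: a candidate of maximum slope. -/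
def IsBest (obs : List Rect) (T u : Point) (e : Entry) : Prop :=
  e ∈ candidates obs T u (table obs T) ∧
    ∀ e' ∈ candidates obs T u (table obs T), slopeOf u e'.vertex ≤ slopeOf u e.vertex

/-- The points stored in the array `𝓐`. The take-off line is `y = t`. -/
def leftEnds (obs : List Rect) (T : Point) (L t : ℝ) : Set Point :=
  {A | ∃ R ∈ obs, ∃ e, IsBest obs T R.upperLeft e ∧
    A 1 = t ∧ A ∈ line[ℝ, R.upperLeft, e.vertex] ∧
    dist A e.vertex + e.len ≤ L ∧ SegFree obs A e.vertex}

/-! ### STEP 3 -/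

/-- The points stored in the array `𝓑`. -/
def rightEnds (obs : List Rect) (T : Point) (L t : ℝ) : Set Point :=
  {B | ∃ e ∈ table obs T,
    B 1 = t ∧ B 0 ≤ e.vertex 0 ∧ dist B e.vertex = L - e.len ∧
    IsCICP obs T B (B :: e.chain) ∧
    ¬ ∃ e' ∈ table obs T, IsCICP obs T B (B :: e'.chain) ∧ chainLength (B :: e'.chain) < L}

/-! ### STEP 4 -/

/-- The points of the list `𝓗`. -/
def ends (obs : List Rect) (T : Point) (L t : ℝ) : Set Point :=
  leftEnds obs T L t ∪ rightEnds obs T L t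

/-- The interval `(A, B)` of the line `y = t`. -/
def openInterval (t : ℝ) (A B : Point) : Set Point := {Y | Y 1 = t ∧ A 0 < Y 0 ∧ Y 0 < B 0}

/-- The interval `[Q, B)` of the line `y = t`. -/
def halfOpenInterval (t : ℝ) (Q B : Point) : Set Point := {Y | Y 1 = t ∧ Q 0 ≤ Y 0 ∧ Y 0 < B 0}

/-- The set `𝓘`: the intervals `(A, B)` such that the right end-point `B` immediately succeeds
the left end-point `A` in `𝓗`, and the interval `[Q, B)` if `𝓗` starts with the right
end-point `B`. -/
def intervals (obs : List Rect) (T Q : Point) (L t : ℝ) : Set (Set Point) :=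
  {J | ∃ A ∈ leftEnds obs T L t, ∃ B ∈ rightEnds obs T L t, A 0 < B 0 ∧
      (¬ ∃ C ∈ ends obs T L t, A 0 < C 0 ∧ C 0 < B 0) ∧ J = openInterval t A B} ∪
  {J | ∃ B ∈ rightEnds obs T L t,
      (¬ ∃ C ∈ ends obs T L t, C 0 < B 0) ∧ J = halfOpenInterval t Q B}

/-- The orthogonal projection `T'` of `T` onto the take-off line `y = t`. -/
def proj (T : Point) (t : ℝ) : Point := !₂[T 0, t]

/-- The output of PVA-2D: the complement of the intervals of `𝓘` within `[Q, T']`. -/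
def output (obs : List Rect) (T Q : Point) (L t : ℝ) : Set Point :=
  segment ℝ Q (proj T t) \ ⋃₀ intervals obs T Q L t

end PVA

end

/-! Let V be the set of abscissas of visible points of the take-off line. It is shown that V is
closed, that a gap of V begins at a left end-point (unless no point to its left is visible) and
finishes at a right end-point, that all end-points are visible, and that invisible points accumulate
at every right end-point from the left. This determines the intervals
(`not_pVisible_iff_mem_interval`).

Two facts about chains carry the argument. First, of two chains from one point, the flatter one can
be replaced by a chain that is at least as steep as the other and is shorter than the flatter one,
strictly so if their first directions differ (`exists_upper_chain`). Hence a shortest chain is also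
steepest, and any edge that some chain can follow can be followed by a shortest one
(`IsShortest.follows`); this is why storing a single chain per vertex loses nothing. Second, a chain
can be pulled taut until its second vertex is a lower-right vertex or T (`exists_node_chain`).
Together they make the table complete (`TableInv`, `pVisible_pt_iff`), so V is a finite union of
closed sets.

At the left end of a component of V the only obstruction is length: below the obstacles a chain can
always be prolonged horizontally to the left (`mem_rightEnds`). At a right end, moving right
shortens the first edge, so the obstruction is a collision. For a shortest chain with a strict first
turn it occurs at an upper-left vertex on the first edge, and the second vertex of the chain is then
the choice of maximum slope (`IsShortest.isBest`, `mem_leftEnds`). -/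

namespace PVA

open Filter Topology

/-! ### Directions in the closed first quadrant -/

/-- The cross product of two plane vectors. -/
def cr (u v : Point) : ℝ := u 0 * v 1 - u 1 * v 0

/-- The vector `d` is nonzero and points into the closed first quadrant. -/
def Quad (d : Point) : Prop := 0 ≤ d 0 ∧ 0 ≤ d 1 ∧ 0 < d 0 + d 1

theorem ext_coord {p q : Point} (h0 : p 0 = q 0) (h1 : p 1 = q 1) : p = q := by
  ext i
  fin_cases i
  · exact h0
  · exact h1

theorem mem_NE_iff {p q : Point} : q ∈ NE p ↔ Quad (q - p) := by
  simp only [NE, Quad, Set.mem_ofPred_eq, PiLp.sub_apply]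
  constructor
  · rintro ⟨h0, h1, h2⟩
    refine ⟨by linarith, by linarith, ?_⟩
    by_contra h
    exact h2 (ext_coord (by linarith) (by linarith))
  · rintro ⟨h0, h1, h2⟩
    refine ⟨by linarith, by linarith, ?_⟩
    rintro rfl
    linarith

theorem NE_trans {p q r : Point} (h : q ∈ NE p) (h' : r ∈ NE q) : r ∈ NE p := by
  rw [mem_NE_iff] at *
  obtain ⟨a, b, c⟩ := h
  obtain ⟨a', b', c'⟩ := h'
  simp only [PiLp.sub_apply] at *
  refine ⟨?_, ?_, ?_⟩ <;> simp only [PiLp.sub_apply] <;> linarith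

theorem Quad.smul {d : Point} (h : Quad d) {s : ℝ} (hs : 0 < s) : Quad (s • d) := by
  obtain ⟨a, b, c⟩ := h
  refine ⟨?_, ?_, ?_⟩ <;> simp only [PiLp.smul_apply, smul_eq_mul]
  · positivity
  · positivity
  · rw [← mul_add]; positivity

theorem cr_smul_left (s : ℝ) (u v : Point) : cr (s • u) v = s * cr u v := by
  simp only [cr, PiLp.smul_apply, smul_eq_mul]; ring

theorem cr_smul_right (s : ℝ) (u v : Point) : cr u (s • v) = s * cr u v := by
  simp only [cr, PiLp.smul_apply, smul_eq_mul]; ring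

theorem cr_add_left (u u' v : Point) : cr (u + u') v = cr u v + cr u' v := by
  simp only [cr, PiLp.add_apply]; ring

theorem cr_add_right (u v v' : Point) : cr u (v + v') = cr u v + cr u v' := by
  simp only [cr, PiLp.add_apply]; ring

theorem cr_sub_right (u v v' : Point) : cr u (v - v') = cr u v - cr u v' := by
  simp only [cr, PiLp.sub_apply]; ring

theorem cr_self (u : Point) : cr u u = 0 := by
  simp only [cr]; ring

theorem cr_swap (u v : Point) : cr u v = -cr v u := by
  simp only [cr]; ring

/-- Turning left is transitive because all directions lie in one quadrant: `b 0 * cr a c = a 0 * cr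
b c + c 0 * cr a b`. If `b` is vertical, so is `c`. -/
theorem cr_trans {a b c : Point} (ha : Quad a) (hb : Quad b) (hc : Quad c)
    (h1 : 0 ≤ cr a b) (h2 : 0 ≤ cr b c) : 0 ≤ cr a c := by
  obtain ⟨a0, a1, _⟩ := ha
  obtain ⟨b0, b1, bs⟩ := hb
  obtain ⟨c0, c1, _⟩ := hc
  simp only [cr] at *
  rcases b0.eq_or_lt with h | h
  · have hc0 : c 0 = 0 := by
      rw [← h] at h2 bs
      nlinarith
    rw [hc0]
    nlinarith [mul_nonneg a0 c1]
  · have : 0 ≤ b 0 * (a 0 * c 1 - a 1 * c 0) := by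
      nlinarith [mul_nonneg a0 h2, mul_nonneg c0 h1]
    exact nonneg_of_mul_nonneg_right this h

theorem cr_trans_lt {a b c : Point} (ha : Quad a) (hb : Quad b) (hc : Quad c)
    (h1 : 0 < cr a b) (h2 : 0 ≤ cr b c) : 0 < cr a c := by
  refine lt_of_le_of_ne (cr_trans ha hb hc h1.le h2) fun h => ?_
  have h3 : 0 ≤ cr c a := by rw [cr_swap]; linarith
  have := cr_trans hb hc ha h2 h3
  rw [cr_swap] at this
  linarith

theorem exists_smul_of_cr_eq_zero {w d : Point} (hw : Quad w) (hd : Quad d) (h : cr w d = 0) :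
    ∃ s : ℝ, 0 < s ∧ d = s • w := by
  obtain ⟨_, _, hw⟩ := hw
  obtain ⟨_, _, hd⟩ := hd
  simp only [cr] at h
  refine ⟨(d 0 + d 1) / (w 0 + w 1), by positivity, ext_coord ?_ ?_⟩ <;>
    simp only [PiLp.smul_apply, smul_eq_mul] <;> field_simp <;> linarith

theorem rightOrOn_iff {p q r : Point} : RightOrOn p q r ↔ 0 ≤ cr (q - p) (r - q) := by
  simp only [RightOrOn, cr, PiLp.sub_apply]
  constructor <;> intro h <;> nlinarith

/-! ### Segments -/

theorem mem_segment_iff {a b z : Point} :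
    z ∈ segment ℝ a b ↔ ∃ τ : ℝ, 0 ≤ τ ∧ τ ≤ 1 ∧ z = a + τ • (b - a) := by
  rw [segment_eq_image']
  simp only [Set.mem_image, Set.mem_Icc, and_assoc, eq_comm]

theorem SegFree.mono {obs : List Rect} {a b z z' : Point} (h : SegFree obs a b)
    (hz : z ∈ segment ℝ a b) (hz' : z' ∈ segment ℝ a b) : SegFree obs z z' := fun R hR =>
  (h R hR).mono_left ((convex_segment a b).segment_subset hz hz')

theorem SegFree.union {obs : List Rect} {a b z : Point} (h : SegFree obs a z)
    (h' : SegFree obs z b) (hz : z ∈ segment ℝ a b) : SegFree obs a b := by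
  intro R hR
  rw [Set.disjoint_left]
  intro x hx hxR
  rw [mem_segment_iff] at hz hx
  obtain ⟨s, hs0, hs1, rfl⟩ := hz
  obtain ⟨τ, ht0, ht1, rfl⟩ := hx
  rcases le_total τ s with hle | hle
  · refine Set.disjoint_left.1 (h R hR) (mem_segment_iff.2 ?_) hxR
    rcases hs0.eq_or_lt with h0 | h0
    · exact ⟨0, le_rfl, zero_le_one, by rw [show τ = 0 by linarith]; simp⟩
    · refine ⟨τ / s, by positivity, by rw [div_le_one h0]; exact hle, ?_⟩
      rw [add_sub_cancel_left, smul_smul, div_mul_cancel₀ _ h0.ne']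
  · refine Set.disjoint_left.1 (h' R hR) (mem_segment_iff.2 ?_) hxR
    rcases hs1.eq_or_lt with h0 | h0
    · exact ⟨0, le_rfl, zero_le_one, by rw [show τ = s by linarith]; simp⟩
    · have h1 : 0 < 1 - s := by linarith
      refine ⟨(τ - s) / (1 - s), div_nonneg (by linarith) h1.le,
        by rw [div_le_one h1]; linarith, ?_⟩
      refine ext_coord ?_ ?_ <;> simp only [PiLp.add_apply, PiLp.sub_apply, PiLp.smul_apply,
        smul_eq_mul] <;> field_simp <;> ring

theorem dist_add_dist_of_mem {a b z : Point} (hz : z ∈ segment ℝ a b) :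
    dist a z + dist z b = dist a b :=
  dist_add_dist_of_mem_segment hz

theorem exists_cut {w q a b : Point} (ha : cr w (a - q) ≤ 0) (hb : 0 ≤ cr w (b - q)) :
    ∃ z ∈ segment ℝ a b, cr w (z - q) = 0 := by
  set α := cr w (a - q) with hα
  set β := cr w (b - q) with hβ
  rcases eq_or_ne (β - α) 0 with h | h
  · exact ⟨a, left_mem_segment ℝ a b, by linarith⟩
  · have hpos : 0 < β - α := lt_of_le_of_ne (by linarith) h.symm
    refine ⟨a + (-α / (β - α)) • (b - a), mem_segment_iff.2
      ⟨_, div_nonneg (by linarith) hpos.le, by rw [div_le_one hpos]; linarith, rfl⟩, ?_⟩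
    have : a + (-α / (β - α)) • (b - a) - q = (a - q) + (-α / (β - α)) • ((b - q) - (a - q)) := by
      rw [sub_sub_sub_cancel_right]; abel
    rw [this, cr_add_right, cr_smul_right, cr_sub_right w (b - q), ← hα, ← hβ]
    field_simp
    ring

/-- A point of a segment lies in the closed quadrant of the lower end. -/
theorem sub_coord_of_mem_segment {a b z : Point} (h : b ∈ NE a) (hz : z ∈ segment ℝ a b) :
    a 0 ≤ z 0 ∧ a 1 ≤ z 1 ∧ z 0 ≤ b 0 ∧ z 1 ≤ b 1 := by
  obtain ⟨τ, h0, h1, rfl⟩ := mem_segment_iff.1 hz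
  obtain ⟨a0, a1, -⟩ := h
  simp only [PiLp.add_apply, PiLp.sub_apply, PiLp.smul_apply, smul_eq_mul]
  refine ⟨?_, ?_, ?_, ?_⟩ <;> nlinarith

theorem mem_NE_of_le {p q r : Point} (h : q ∈ NE p) (h0 : q 0 ≤ r 0) (h1 : q 1 ≤ r 1) :
    r ∈ NE p := by
  rw [mem_NE_iff] at *
  obtain ⟨a, b, c⟩ := h
  simp only [PiLp.sub_apply] at *
  refine ⟨?_, ?_, ?_⟩ <;> simp only [PiLp.sub_apply] <;> linarith

theorem cr_sub_of_mem_segment {a b z : Point} (hz : z ∈ segment ℝ a b) :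
    ∃ τ : ℝ, 0 ≤ τ ∧ τ ≤ 1 ∧ z - a = τ • (b - a) ∧ b - z = (1 - τ) • (b - a) := by
  obtain ⟨τ, h0, h1, rfl⟩ := mem_segment_iff.1 hz
  refine ⟨τ, h0, h1, by abel, ?_⟩
  rw [sub_smul, one_smul]; abel

/-! ### Chains -/

/-- The first edge of the chain turns left of, or continues, the direction `d`. -/
def Follows (d : Point) : List Point → Prop
  | p :: q :: _ => 0 ≤ cr d (q - p)
  | _ => True

theorem Follows.smul {d : Point} {c : List Point} (h : Follows d c) {s : ℝ} (hs : 0 ≤ s) :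
    Follows (s • d) c := by
  match c, h with
  | [], _ => trivial
  | [_], _ => trivial
  | p :: q :: _, h =>
    change 0 ≤ cr _ _
    rw [cr_smul_left]
    exact mul_nonneg hs h

variable {obs : List Rect} {T : Point}

theorem IsCICP.exists_eq_cons {p : Point} {c : List Point} (h : IsCICP obs T p c) :
    ∃ c', c = p :: c' := by
  have := h.head
  cases c with
  | nil => simp at this
  | cons a c' => simp at this; exact ⟨c', by rw [this]⟩

theorem isCICP_singleton (p : Point) : IsCICP obs p p [p] :=
  ⟨rfl, rfl, trivial, trivial, trivial⟩

theorem isCICP_singleton_iff {p : Point} : IsCICP obs T p [p] ↔ p = T := by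
  constructor
  · intro h; simpa using h.last
  · rintro rfl; exact isCICP_singleton p

theorem isCICP_cons_iff {p q : Point} {c : List Point} (hc : c.head? = some q) :
    IsCICP obs T p (p :: c) ↔
      q ∈ NE p ∧ SegFree obs p q ∧ Follows (q - p) c ∧ IsCICP obs T q c := by
  cases c with
  | nil => simp at hc
  | cons a c =>
    simp only [List.head?_cons, Option.some.injEq] at hc
    subst hc
    constructor
    · intro h
      refine ⟨h.increasing.1, h.collisionFree.1, ?_, rfl, ?_, h.collisionFree.2,
        h.increasing.2, ?_⟩
      · cases c with
        | nil => trivial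
        | cons r c => exact rightOrOn_iff.1 h.convex.1
      · simpa [List.getLast?_cons_cons] using h.last
      · cases c with
        | nil => trivial
        | cons r c => exact h.convex.2
    · rintro ⟨h1, h2, h3, h4⟩
      refine ⟨rfl, ?_, ⟨h2, h4.collisionFree⟩, ⟨h1, h4.increasing⟩, ?_⟩
      · simpa [List.getLast?_cons_cons] using h4.last
      · cases c with
        | nil => trivial
        | cons r c => exact ⟨rightOrOn_iff.2 h3, h4.convex⟩

theorem IsCICP.cons {p q : Point} {c : List Point} (h : IsCICP obs T q c) (h1 : q ∈ NE p)
    (h2 : SegFree obs p q) (h3 : Follows (q - p) c) : IsCICP obs T p (p :: c) :=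
  (isCICP_cons_iff h.head).2 ⟨h1, h2, h3, h⟩

/-- Case analysis on the first edge of a chain. -/
theorem IsCICP.cases_edge {p : Point} {c : List Point} (h : IsCICP obs T p c) :
    (p = T ∧ c = [p]) ∨ ∃ q c', c = p :: q :: c' ∧ q ∈ NE p ∧ SegFree obs p q ∧
      Follows (q - p) (q :: c') ∧ IsCICP obs T q (q :: c') := by
  obtain ⟨c', rfl⟩ := h.exists_eq_cons
  cases c' with
  | nil => exact Or.inl ⟨isCICP_singleton_iff.1 h, rfl⟩
  | cons q c' => exact Or.inr ⟨q, c', rfl, (isCICP_cons_iff rfl).1 h⟩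

theorem chainLength_cons {p q : Point} {c : List Point} (hc : c.head? = some q) :
    chainLength (p :: c) = dist p q + chainLength c := by
  cases c with
  | nil => simp at hc
  | cons a c =>
    simp only [List.head?_cons, Option.some.injEq] at hc
    subst hc
    rfl

theorem Follows.trans {d q p : Point} {c : List Point} (hd : Quad d) (hq : q ∈ NE p)
    (h : 0 ≤ cr d (q - p)) (hc : IsCICP obs T q c) (hf : Follows (q - p) c) : Follows d c := by
  rcases hc.cases_edge with ⟨-, rfl⟩ | ⟨r, c', rfl, hr, -⟩
  · trivial
  · exact cr_trans hd (mem_NE_iff.1 hq) (mem_NE_iff.1 hr) h hf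

theorem IsCICP.le_end {c : List Point} : ∀ {p : Point}, IsCICP obs T p c →
    p 0 ≤ T 0 ∧ p 1 ≤ T 1 := by
  induction c with
  | nil => intro p h; simpa using h.head
  | cons a c ih =>
    intro p h
    rcases h.cases_edge with ⟨rfl, -⟩ | ⟨q, c', hc, hq, -, -, h'⟩
    · exact ⟨le_rfl, le_rfl⟩
    · obtain ⟨rfl, rfl⟩ := List.cons.inj hc
      exact ⟨hq.1.trans (ih h').1, hq.2.1.trans (ih h').2⟩

/-- By transitivity every edge of the chain is to the left of `d` or parallel to it, and `T - p` is
the sum of the edges. -/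
theorem IsCICP.cr_end {c : List Point} : ∀ {p d : Point}, IsCICP obs T p c → Quad d →
    Follows d c → 0 ≤ cr d (T - p) := by
  induction c with
  | nil => intro p d h; simpa using h.head
  | cons a c ih =>
    intro p d h hd hf
    rcases h.cases_edge with ⟨rfl, -⟩ | ⟨q, c', hc, hq, -, hf', h'⟩
    · simp [cr]
    · obtain ⟨rfl, rfl⟩ := List.cons.inj hc
      have := ih h' hd (Follows.trans hd hq hf h' hf')
      rw [show T - a = (q - a) + (T - q) by abel, cr_add_right]
      exact add_nonneg hf this

theorem IsCICP.dist_le {c : List Point} : ∀ {p : Point}, IsCICP obs T p c →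
    dist p T ≤ chainLength c := by
  induction c with
  | nil => intro p h; simpa using h.head
  | cons a c ih =>
    intro p h
    rcases h.cases_edge with ⟨rfl, hc⟩ | ⟨q, c', hc, hq, -, hf', h'⟩
    · simp [hc, chainLength]
    · obtain ⟨rfl, rfl⟩ := List.cons.inj hc
      rw [chainLength_cons rfl]
      exact (dist_triangle a q T).trans (add_le_add le_rfl (ih h'))

theorem IsCICP.eq_singleton {c : List Point} (h : IsCICP obs T T c) : c = [T] := by
  rcases h.cases_edge with ⟨-, rfl⟩ | ⟨q, c', -, hq, -, -, h'⟩
  · rfl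
  · exact absurd (ext_coord (le_antisymm h'.le_end.1 hq.1) (le_antisymm h'.le_end.2 hq.2.1)) hq.2.2

/-! ### Comparison of two chains from one point -/

/-- The ray from `q` in the direction `w` meets a chain that starts to its right and ends to its
left; following the ray up to the chain gives a path that is not longer. -/
theorem exists_ray_meets {q w : Point} (hw : Quad w) (hT : 0 ≤ cr w (T - q)) {c : List Point} :
    ∀ {v : Point}, IsCICP obs T v c → v ∈ NE q → cr w (v - q) ≤ 0 →
    ∃ z d, z ∈ NE q ∧ cr w (z - q) = 0 ∧ IsCICP obs T z d ∧ Follows w d ∧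
      dist q z + chainLength d ≤ dist q v + chainLength c ∧
      (cr w (v - q) < 0 → dist q z + chainLength d < dist q v + chainLength c) := by
  induction c with
  | nil => intro v h; simpa using h.head
  | cons a c ih =>
    intro v h hv hneg
    rcases h.cases_edge with ⟨rfl, hc⟩ | ⟨b, c', hc, hb, hfree, hf, h'⟩
    · have h0 := le_antisymm hneg hT
      rw [hc] at h ⊢
      exact ⟨v, [v], hv, h0, h, trivial, le_rfl, fun h => absurd h0 h.ne⟩
    · obtain ⟨rfl, rfl⟩ := List.cons.inj hc
      rw [chainLength_cons rfl]
      rcases lt_or_ge (cr w (b - q)) 0 with hbq | hbq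
      · obtain ⟨z, d, h1, h2, h3, h4, -, h6⟩ := ih h' (NE_trans hv hb) hbq.le
        have := h6 hbq
        have := dist_triangle q a b
        exact ⟨z, d, h1, h2, h3, h4, by linarith, fun _ => by linarith⟩
      -- The edge from `a` to `b` is the first to reach the ray. The chain is cut at `z`, which may
      -- be the vertex `b` itself.
      · obtain ⟨z, hz, hz0⟩ := exists_cut hneg hbq
        have hzc := sub_coord_of_mem_segment hb hz
        have hzq : z ∈ NE q := mem_NE_of_le hv hzc.1 hzc.2.1
        have hwb : 0 ≤ cr w (b - a) := by
          rw [show b - a = (b - q) - (a - q) by abel, cr_sub_right]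
          linarith
        obtain ⟨d, hd, hwd, hlen⟩ : ∃ d, IsCICP obs T z d ∧ Follows w d ∧
            chainLength d = dist z b + chainLength (b :: c') := by
          obtain ⟨τ, t0, t1, e1, e2⟩ := cr_sub_of_mem_segment hz
          rcases t1.eq_or_lt with ht | ht
          · have : z = b := by
              rw [ht] at e2
              simpa [sub_eq_zero, eq_comm] using e2
            subst this
            exact ⟨z :: c', h', Follows.trans hw hb hwb h' hf, by simp⟩
          · have ht : 0 < 1 - τ := by linarith
            refine ⟨z :: b :: c', h'.cons ?_ (hfree.mono hz (right_mem_segment ℝ a b)) ?_, ?_, rfl⟩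
            · rw [mem_NE_iff, e2]
              exact (mem_NE_iff.1 hb).smul ht
            · rw [e2]; exact hf.smul ht.le
            · change 0 ≤ cr _ _
              rw [e2, cr_smul_right]; positivity
        have htri := dist_triangle q a z
        have hadd := dist_add_dist_of_mem hz
        refine ⟨z, d, hzq, hz0, hd, hwd, by rw [hlen]; linarith, fun hlt => ?_⟩
        -- Equality in the triangle inequality would put `a` on the ray, but `a` is strictly to its
        -- right.
        have : dist q a + dist a z ≠ dist q z := by
          intro he
          rw [dist_add_dist_eq_iff, ← mem_segment_iff_wbtw] at he
          obtain ⟨τ, t0, t1, e1, -⟩ := cr_sub_of_mem_segment he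
          rw [e1, cr_smul_right, hz0, mul_zero] at hlt
          exact lt_irrefl _ hlt
        have := lt_of_le_of_ne htri this.symm
        rw [hlen]; linarith

/-- Two chains start from `q`. There is a chain that starts at least as steeply as the steeper of
them and that is not longer than the other. -/
theorem exists_upper_chain {c₂ : List Point} : ∀ {q v w : Point} {c₁ : List Point},
    IsCICP obs T v c₁ → v ∈ NE q → IsCICP obs T w c₂ → w ∈ NE q → SegFree obs q w →
    Follows (w - q) c₂ → 0 ≤ cr (v - q) (w - q) →
    ∃ z c, z ∈ NE q ∧ SegFree obs q z ∧ Follows (z - q) c ∧ IsCICP obs T z c ∧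
      0 ≤ cr (w - q) (z - q) ∧ dist q z + chainLength c ≤ dist q v + chainLength c₁ ∧
      (0 < cr (v - q) (w - q) → dist q z + chainLength c < dist q v + chainLength c₁) := by
  induction c₂ with
  | nil => intro q v w c₁ _ _ h; simpa using h.head
  | cons a c₂ ih =>
    intro q v w c₁ h₁ hv h₂ hw hfree hf hcr
    have hW := mem_NE_iff.1 hw
    have hT : 0 ≤ cr (w - q) (T - q) := by
      rw [show T - q = (w - q) + (T - w) by abel, cr_add_right, cr_self, zero_add]
      exact h₂.cr_end hW hf
    obtain ⟨z, d, hz, hz0, hd, hfd, hlen, hlt⟩ :=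
      exists_ray_meets hW hT h₁ hv (by rw [cr_swap]; linarith)
    rw [cr_swap, neg_lt_zero] at hlt
    -- The ray along the first steep edge meets the other chain at `q + s • (w - q)`. If `s ≤ 1`,
    -- this is on the edge and the other chain is joined there; otherwise the whole edge is used and
    -- the comparison is repeated from its end.
    obtain ⟨s, hs, hsz⟩ := exists_smul_of_cr_eq_zero hW (mem_NE_iff.1 hz) hz0
    rcases le_or_gt s 1 with hs1 | hs1
    · refine ⟨z, d, hz, hfree.mono (left_mem_segment ℝ q w)
        (mem_segment_iff.2 ⟨s, hs.le, hs1, ?_⟩), ?_, hd, hz0.ge, hlen, hlt⟩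
      · rw [← hsz]; abel
      · rw [hsz]; exact hfd.smul hs.le
    · have hzw : z - w = (s - 1) • (w - q) := by
        rw [sub_smul, one_smul, ← hsz]; abel
      have hs1' : 0 < s - 1 := by linarith
      have hzNE : z ∈ NE w := by rw [mem_NE_iff, hzw]; exact hW.smul hs1'
      rcases h₂.cases_edge with ⟨rfl, -⟩ | ⟨w₂, c', hc, hw₂, hfree₂, hf₂, h₂'⟩
      · exact absurd (ext_coord (le_antisymm hd.le_end.1 hzNE.1)
          (le_antisymm hd.le_end.2 hzNE.2.1)) hzNE.2.2
      · obtain ⟨rfl, rfl⟩ := List.cons.inj hc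
        -- The segment from `a` to `z` may collide. This is harmless: only the steeper chain needs a
        -- free first edge.
        obtain ⟨z', c, g1, g2, g3, g4, g5, g6, -⟩ := ih hd hzNE h₂' hw₂ hfree₂ hf₂ (by
          rw [hzw, cr_smul_left]; exact mul_nonneg hs1'.le hf)
        have hlen' : dist q a + dist a z = dist q z := by
          refine dist_add_dist_of_mem (mem_segment_iff.2 ⟨s⁻¹, by positivity,
            inv_le_one_of_one_le₀ hs1.le, ?_⟩)
          rw [hsz, smul_smul, inv_mul_cancel₀ hs.ne', one_smul]; abel
        have hfol : Follows (a - q) (a :: c) := by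
          obtain ⟨c0, rfl⟩ := g4.exists_eq_cons
          exact cr_trans hW (mem_NE_iff.1 hw₂) (mem_NE_iff.1 g1) hf g5
        refine ⟨a, a :: c, hw, hfree, hfol, g4.cons g1 g2 g3, (cr_self _).ge, ?_, fun h => ?_⟩
        · rw [chainLength_cons g4.head]; linarith
        · have := hlt h
          rw [chainLength_cons g4.head]; linarith

/-! ### Chains through lower-right vertices -/

/-- The point is the target or a lower-right vertex of an obstacle. -/
def IsNode (obs : List Rect) (T z : Point) : Prop := z = T ∨ ∃ R ∈ obs, z = R.lowerRight

/-- Cramer's rule. -/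
theorem cr_decomp {A B : Point} (h : cr A B ≠ 0) (u : Point) :
    u = (cr u B / cr A B) • A + (cr A u / cr A B) • B := by
  refine ext_coord ?_ ?_ <;>
    simp only [PiLp.add_apply, PiLp.smul_apply, smul_eq_mul] <;> field_simp <;>
    simp only [cr] <;> ring

theorem quad_of_left {A d : Point} (hA : Quad A) (hd : 0 < d 0) (h : 0 ≤ cr A d) : Quad d := by
  obtain ⟨a0, a1, ha⟩ := hA
  simp only [cr] at h
  have : 0 ≤ d 1 := by
    rcases a0.eq_or_lt with h0 | h0
    · rw [← h0] at h ha
      nlinarith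
    · by_contra hneg
      nlinarith [mul_nonneg a1 hd.le]
  exact ⟨hd.le, this, by linarith⟩

theorem cr_neg_of_right_down {A δ : Point} (hA : Quad A) (h0 : 0 < δ 0) (h1 : δ 1 < 0) :
    cr A δ < 0 := by
  obtain ⟨a0, a1, ha⟩ := hA
  simp only [cr]
  rcases a0.eq_or_lt with h | h
  · rw [← h] at ha ⊢
    nlinarith
  · nlinarith

theorem inside_of_toward_lowerRight {R : Rect} {m : Point} (hm : m ∈ R.inside) {τ : ℝ}
    (h0 : 0 ≤ τ) (h1 : τ < 1) : m + τ • (R.lowerRight - m) ∈ R.inside := by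
  obtain ⟨m1, m2, m3, m4⟩ := hm
  refine ⟨?_, ?_, ?_, ?_⟩ <;> simp [Rect.lowerRight] <;> nlinarith

/-- A point of a triangle that is on the line of one of the two lower edges is on that edge. -/
theorem mem_segment_of_boundary {p v z x : Point} (hD : 0 < cr (v - p) (z - v))
    (hx1 : 0 ≤ cr (v - p) (x - p)) (hx2 : 0 ≤ cr (z - v) (x - v)) (hx3 : 0 ≤ cr (x - p) (z - p))
    (hor : cr (v - p) (x - p) = 0 ∨ cr (z - v) (x - v) = 0) :
    x ∈ segment ℝ p v ∨ x ∈ segment ℝ v z := by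
  have hzp : z - p = (v - p) + (z - v) := by abel
  rw [hzp] at hx3
  have hAdef : x - v = (x - p) - (v - p) := by abel
  have hBA : cr (z - v) (v - p) = -cr (v - p) (z - v) := cr_swap _ _
  rcases hor with h | h
  · left
    have hd := cr_decomp hD.ne' (x - p)
    rw [h, zero_div, zero_smul, add_zero] at hd
    set s := cr (x - p) (z - v) / cr (v - p) (z - v)
    refine mem_segment_iff.2 ⟨s, ?_, ?_, ?_⟩
    · rw [hd, cr_smul_left, cr_add_right, cr_self, zero_add] at hx3
      exact nonneg_of_mul_nonneg_left hx3 hD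
    · rw [hAdef, hd, cr_sub_right, cr_smul_right, hBA] at hx2
      nlinarith
    · rw [← hd]; abel
  · right
    have hd := cr_decomp hD.ne' (x - v)
    rw [cr_swap (x - v) (z - v), h, neg_zero, zero_div, zero_smul, zero_add] at hd
    set s := cr (v - p) (x - v) / cr (v - p) (z - v)
    have hxp : x - p = (v - p) + s • (z - v) := by rw [← hd]; abel
    refine mem_segment_iff.2 ⟨s, ?_, ?_, ?_⟩
    · rw [hxp, cr_add_right, cr_self, zero_add, cr_smul_right] at hx1
      exact nonneg_of_mul_nonneg_left hx1 hD
    · rw [hxp, cr_add_left, cr_add_right, cr_smul_left, cr_add_right, cr_self, cr_self, hBA] at hx3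
      nlinarith
    · rw [← hd]; abel

/-- An obstacle that crosses the chord of a free two-edge convex chain has its lower-right vertex
in the triangle. -/
theorem lowerRight_mem_triangle {p v z m : Point} {R : Rect} (hv : v ∈ NE p) (hz : z ∈ NE v)
    (hD : 0 < cr (v - p) (z - v)) (hR : R ∈ obs) (hpv : SegFree obs p v) (hvz : SegFree obs v z)
    (hm : m ∈ segment ℝ p z) (hmR : m ∈ R.inside) :
    p 0 < R.lowerRight 0 ∧ 0 < cr (R.lowerRight - p) (z - p) ∧
      0 ≤ cr (v - p) (R.lowerRight - p) ∧ 0 ≤ cr (z - v) (R.lowerRight - v) := by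
  have hNE := NE_trans hv hz
  have hm0 := (sub_coord_of_mem_segment hNE hm).1
  obtain ⟨t, t0, t1, e1, -⟩ := cr_sub_of_mem_segment hm
  have hA := mem_NE_iff.1 hv
  have hB := mem_NE_iff.1 hz
  set l := R.lowerRight with hl
  have hδ0 : 0 < (l - m) 0 := by
    have := hmR.2.1
    simp [hl, Rect.lowerRight]; linarith
  have hδ1 : (l - m) 1 < 0 := by
    have := hmR.2.2.1
    simp [hl, Rect.lowerRight]; linarith
  have hlm : m 0 < l 0 := by simpa using hδ0
  set δ := l - m with hδ
  set A := v - p with hAdef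
  set B := z - v with hBdef
  have hzp : z - p = A + B := by rw [hAdef, hBdef]; abel
  have hκ1 := cr_neg_of_right_down hA hδ0 hδ1
  have hκ2 := cr_neg_of_right_down hB hδ0 hδ1
  have hκ : 0 < cr δ (A + B) := by
    rw [cr_swap, cr_add_left]; linarith
  have hBA : cr B A = -cr A B := cr_swap _ _
  have hmp : m - p = t • (A + B) := by rw [e1, hzp]
  have f1 : ∀ τ : ℝ, cr A (m + τ • δ - p) = t * cr A B + τ * cr A δ := by
    intro τ
    rw [show m + τ • δ - p = t • (A + B) + τ • δ by rw [← hmp]; abel]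
    simp only [cr_add_right, cr_smul_right, cr_self]; ring
  have f2 : ∀ τ : ℝ, cr B (m + τ • δ - v) = (1 - t) * cr A B + τ * cr B δ := by
    intro τ
    rw [show m + τ • δ - v = t • (A + B) - A + τ • δ by rw [← hmp, hAdef]; abel]
    simp only [cr_add_right, cr_sub_right, cr_smul_right, cr_self, hBA]; ring
  have f3 : ∀ τ : ℝ, cr (m + τ • δ - p) (A + B) = τ * cr δ (A + B) := by
    intro τ
    rw [show m + τ • δ - p = t • (A + B) + τ • δ by rw [← hmp]; abel]
    simp only [cr_add_left, cr_smul_left]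
    simp only [cr]; simp only [PiLp.add_apply]; ring
  have hlast : m + (1 : ℝ) • δ = l := by rw [one_smul, hδ]; abel
  refine ⟨by linarith, ?_, ?_⟩
  · have := f3 1
    rw [hlast] at this
    rw [hzp, this]; linarith
  have g1 := f1 1
  have g2 := f2 1
  rw [hlast] at g1 g2
  rw [g1, g2]
  by_contra hcon
  have hcon : t * cr A B + 1 * cr A δ < 0 ∨ (1 - t) * cr A B + 1 * cr B δ < 0 := by
    by_contra hh
    push Not at hh
    exact hcon hh
  -- A point moving straight from `m` to the lower-right vertex stays inside `R` until it arrives,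
  -- so it cannot meet a free edge of the triangle earlier.
  have key : ∀ τ : ℝ, 0 ≤ τ → τ < 1 → 0 ≤ cr A (m + τ • δ - p) → 0 ≤ cr B (m + τ • δ - v) →
      (cr A (m + τ • δ - p) = 0 ∨ cr B (m + τ • δ - v) = 0) → False := by
    intro τ h0 h1 hx1 hx2 hor
    have hin := inside_of_toward_lowerRight hmR h0 h1
    rw [← hl, ← hδ] at hin
    have hx3 : 0 ≤ cr (m + τ • δ - p) (A + B) := by rw [f3]; positivity
    rw [← hzp] at hx3
    rcases mem_segment_of_boundary hD hx1 hx2 hx3 hor with h | h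
    · exact Set.disjoint_left.1 (hpv R hR) h hin
    · exact Set.disjoint_left.1 (hvz R hR) h hin
  set κ₁ := -cr A δ with hk1
  set κ₂ := -cr B δ with hk2
  have k1 : 0 < κ₁ := by linarith
  have k2 : 0 < κ₂ := by linarith
  have e1 : cr A δ = -κ₁ := by rw [hk1]; ring
  have e2 : cr B δ = -κ₂ := by rw [hk2]; ring
  simp only [e1, e2] at f1 f2 hcon
  -- The moving point reaches the lines `pv` and `vz` at these two times. If the vertex were outside
  -- the triangle, the smaller time would be below 1 and the point would then be on an edge.
  have hτ1 : t * cr A B / κ₁ * κ₁ = t * cr A B := div_mul_cancel₀ _ k1.ne'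
  have hτ2 : (1 - t) * cr A B / κ₂ * κ₂ = (1 - t) * cr A B := div_mul_cancel₀ _ k2.ne'
  have p1 : 0 ≤ t * cr A B / κ₁ := by positivity
  have p2 : 0 ≤ (1 - t) * cr A B / κ₂ :=
    div_nonneg (mul_nonneg (by linarith) hD.le) k2.le
  set τ₁ := t * cr A B / κ₁
  set τ₂ := (1 - t) * cr A B / κ₂
  have hlt : τ₁ < 1 ∨ τ₂ < 1 := by
    rcases hcon with h | h
    · left; by_contra hh; nlinarith
    · right; by_contra hh; nlinarith
  rcases le_total τ₁ τ₂ with h | h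
  · refine key τ₁ p1 (by rcases hlt with h' | h' <;> linarith) ?_ ?_ (Or.inl ?_)
    · rw [f1]; linarith
    · rw [f2]; nlinarith
    · rw [f1]; linarith
  · refine key τ₂ p2 (by rcases hlt with h' | h' <;> linarith) ?_ ?_ (Or.inr ?_)
    · rw [f1]; nlinarith
    · rw [f2]; linarith
    · rw [f2]; linarith

/-- The chain `p`, `v`, `q`, … can be shortened to one whose second vertex is a node. -/
theorem exists_node_of_triangle (n : ℕ) : ∀ {p v q : Point} {c : List Point},
    {l | l ∈ obs.map Rect.lowerRight ∧ l ∈ NE p}.ncard < n →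
    v ∈ NE p → q ∈ NE v → 0 ≤ cr (v - p) (q - v) → SegFree obs p v → SegFree obs v q →
    IsNode obs T q → IsCICP obs T q c → Follows (q - v) c →
    ∃ z c', IsNode obs T z ∧ z ∈ NE p ∧ SegFree obs p z ∧ Follows (z - p) c' ∧
      IsCICP obs T z c' ∧ 0 ≤ cr (v - p) (z - p) ∧
      dist p z + chainLength c' ≤ dist p v + dist v q + chainLength c := by
  induction n with
  | zero => intro p v q c h; exact absurd h (Nat.not_lt_zero _)
  | succ n ih =>
  intro p v q c hn hv hq hcr hpv hvq hnode hc hf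
  have hpq := NE_trans hv hq
  have hA := mem_NE_iff.1 hv
  have hB := mem_NE_iff.1 hq
  have hqp : q - p = (v - p) + (q - v) := by abel
  by_cases hfree : SegFree obs p q
  · refine ⟨q, c, hnode, hpq, hfree, ?_, hc, ?_, by linarith [dist_triangle p v q]⟩
    · refine Follows.trans (mem_NE_iff.1 hpq) hq ?_ hc hf
      rw [hqp, cr_add_left, cr_self, add_zero]; exact hcr
    · rw [hqp, cr_add_right, cr_self, zero_add]; exact hcr
  have hD : 0 < cr (v - p) (q - v) := by
    refine lt_of_le_of_ne hcr fun h => hfree (hpv.union hvq ?_)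
    obtain ⟨s, hs, e⟩ := exists_smul_of_cr_eq_zero hA hB h.symm
    refine mem_segment_iff.2 ⟨(1 + s)⁻¹, by positivity, inv_le_one_of_one_le₀ (by linarith), ?_⟩
    rw [hqp, e, show (v - p) + s • (v - p) = (1 + s) • (v - p) by rw [add_smul, one_smul],
      smul_smul, inv_mul_cancel₀ (by positivity), one_smul]
    abel
  set S : Set Point := {l | l ∈ obs.map Rect.lowerRight ∧ p 0 < l 0 ∧ 0 < cr (l - p) (q - p) ∧
    0 ≤ cr (v - p) (l - p) ∧ 0 ≤ cr (q - v) (l - v)} with hS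
  have hfin : S.Finite := (obs.map Rect.lowerRight).finite_toSet.subset fun l hl => hl.1
  have hne : S.Nonempty := by
    simp only [SegFree, not_forall, Set.not_disjoint_iff] at hfree
    obtain ⟨R, hR, m, hm, hmR⟩ := hfree
    exact ⟨R.lowerRight, List.mem_map_of_mem hR,
      lowerRight_mem_triangle hv hq hD hR hpv hvq hm hmR⟩
  obtain ⟨a, haS, hmin⟩ := Set.exists_min_image S (fun l => (l 1 - p 1) / (l 0 - p 0)) hfin hne
  obtain ⟨haR, ha0, ha1, ha2, ha3⟩ := haS
  have hquad : ∀ l : Point, p 0 < l 0 → 0 ≤ cr (v - p) (l - p) → Quad (l - p) := fun l h0 h1 =>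
    quad_of_left hA (by simpa using h0) h1
  have hQa := hquad a ha0 ha2
  have haNE : a ∈ NE p := mem_NE_iff.2 hQa
  obtain ⟨z, hz, hz0⟩ := exists_cut (w := a - p) (q := p) (a := v) (b := q)
    (by rw [cr_swap]; linarith) ha1.le
  have hzc := sub_coord_of_mem_segment hq hz
  have hzp : z ∈ NE p := mem_NE_of_le hv hzc.1 hzc.2.1
  obtain ⟨s, hs, hsz⟩ := exists_smul_of_cr_eq_zero hQa (mem_NE_iff.1 hzp) hz0
  obtain ⟨τ, t0, t1, e1, e2⟩ := cr_sub_of_mem_segment hz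
  -- An obstacle across `pz` would have its lower-right vertex in the triangle `p`, `v`, `z`, at a
  -- smaller slope than `a`.
  have hzfree : SegFree obs p z := by
    rcases t0.eq_or_lt with h | h
    · rw [← h, zero_smul, sub_eq_zero] at e1
      rw [e1]; exact hpv
    · intro R hR
      rw [Set.disjoint_left]
      intro m hm hmR
      obtain ⟨g0, g1, g2, g3⟩ := lowerRight_mem_triangle hv
        (mem_NE_iff.2 (by rw [e1]; exact hB.smul h)) (by rw [e1, cr_smul_right]; positivity) hR hpv
        (hvq.mono (left_mem_segment ℝ v q) hz) hm hmR
      have hQl := hquad _ g0 g2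
      rw [e1, cr_smul_left] at g3
      have hlS : R.lowerRight ∈ S := by
        refine ⟨List.mem_map_of_mem hR, g0, ?_, g2, nonneg_of_mul_nonneg_right g3 h⟩
        refine cr_trans_lt hQl (mem_NE_iff.1 hzp) (mem_NE_iff.1 hpq) g1 ?_
        rw [hsz, cr_smul_left]; positivity
      have hle := hmin _ hlS
      simp only at hle
      rw [div_le_div_iff₀ (by linarith) (by linarith)] at hle
      rw [hsz, cr_smul_right] at g1
      have := pos_of_mul_pos_right g1 hs.le
      simp only [cr, PiLp.sub_apply] at this
      linarith
  -- `a` is not beyond the side `vq`, so the ray meets it no later than `z`.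
  have hs1 : 1 ≤ s := by
    have k1 : cr (q - v) (z - v) = 0 := by rw [e1, cr_smul_right, cr_self, mul_zero]
    rw [show z - v = s • (a - v) - (1 - s) • (v - p) by
      rw [show z - v = (z - p) - (v - p) by abel, hsz]; module,
      cr_sub_right, cr_smul_right, cr_smul_right, cr_swap _ (v - p)] at k1
    have := mul_nonneg hs.le ha3
    nlinarith
  have haz : a ∈ segment ℝ p z := by
    refine mem_segment_iff.2 ⟨s⁻¹, by positivity, inv_le_one_of_one_le₀ hs1, ?_⟩
    rw [hsz, smul_smul, inv_mul_cancel₀ hs.ne', one_smul]; abel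
  have haN : IsNode obs T a := by
    obtain ⟨R, hR, rfl⟩ := List.mem_map.1 haR
    exact Or.inr ⟨R, hR, rfl⟩
  have hafree := hzfree.mono (left_mem_segment ℝ p z) haz
  have hzq : 0 < cr (a - p) (q - z) := by
    rw [show q - z = (q - p) - (z - p) by abel, cr_sub_right, hz0]; linarith
  have ht1 : 0 < 1 - τ := by
    refine lt_of_le_of_ne (by linarith) fun h => ?_
    rw [e2, ← h, zero_smul] at hzq
    simp [cr] at hzq
  have hzq' : q ∈ NE z := by rw [mem_NE_iff, e2]; exact hB.smul ht1
  have hzqfree := hvq.mono hz (right_mem_segment ℝ v q)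
  have hzf : Follows (q - z) c := by rw [e2]; exact hf.smul ht1.le
  have hd1 := dist_add_dist_of_mem hz
  have hd2 := dist_add_dist_of_mem haz
  have hd3 := dist_triangle p v z
  rcases eq_or_ne a z with haz' | haz'
  · rw [← haz'] at hzq' hzqfree hzf hd1 hd3 hzq
    refine ⟨a, a :: c, haN, haNE, hafree, ?_, hc.cons hzq' hzqfree hzf, ha2, ?_⟩
    · obtain ⟨c0, rfl⟩ := hc.exists_eq_cons
      exact hzq.le
    · rw [chainLength_cons hc.head]; linarith
  · have hza : z - a = (s - 1) • (a - p) := by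
      rw [sub_smul, one_smul, ← hsz]; abel
    have hs1' : 0 < s - 1 := by
      refine lt_of_le_of_ne (by linarith) fun h => haz' ?_
      rw [← h, zero_smul, sub_eq_zero] at hza
      exact hza.symm
    -- The corner `z` remains to be cut off from `a`. The count drops because `a` itself is not in
    -- `NE a`.
    obtain ⟨z', c', g1, g2, g3, g4, g5, g6, g7⟩ := ih (p := a) (v := z) (q := q) (c := c)
      (by
        have hss : {l | l ∈ obs.map Rect.lowerRight ∧ l ∈ NE a} ⊂
            {l | l ∈ obs.map Rect.lowerRight ∧ l ∈ NE p} :=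
          ⟨fun l hl => ⟨hl.1, NE_trans haNE hl.2⟩,
            fun h => (h (show _ ∧ _ from ⟨haR, haNE⟩)).2.2.2 rfl⟩
        exact (Set.ncard_lt_ncard hss ((obs.map Rect.lowerRight).finite_toSet.subset
          fun l hl => hl.1)).trans_le (Nat.lt_succ_iff.1 hn))
      (by rw [mem_NE_iff, hza]; exact hQa.smul hs1') hzq'
      (by rw [hza, cr_smul_left]; positivity)
      (hzfree.mono haz (right_mem_segment ℝ p z)) hzqfree hnode hc hzf
    refine ⟨a, a :: c', haN, haNE, hafree, ?_, g5.cons g2 g3 g4, ha2, ?_⟩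
    · obtain ⟨c0, rfl⟩ := g5.exists_eq_cons
      rw [hza, cr_smul_left] at g6
      exact nonneg_of_mul_nonneg_right g6 hs1'
    · rw [chainLength_cons g5.head]; linarith

/-- Every chain can be replaced by one that is not longer, that starts at least as steeply, and
whose second vertex is a node. -/
theorem exists_node_chain {c : List Point} : ∀ {p v : Point}, IsCICP obs T v c → v ∈ NE p →
    SegFree obs p v → Follows (v - p) c →
    ∃ z c', IsNode obs T z ∧ z ∈ NE p ∧ SegFree obs p z ∧ Follows (z - p) c' ∧
      IsCICP obs T z c' ∧ 0 ≤ cr (v - p) (z - p) ∧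
      dist p z + chainLength c' ≤ dist p v + chainLength c := by
  induction c with
  | nil => intro p v h; simpa using h.head
  | cons a c ih =>
    intro p v h hv hfree hf
    rcases h.cases_edge with ⟨rfl, hc⟩ | ⟨r, c', hc, hr, hfree', hf', h'⟩
    · exact ⟨v, a :: c, Or.inl rfl, hv, hfree, hf, h, (cr_self _).ge, le_rfl⟩
    · obtain ⟨rfl, rfl⟩ := List.cons.inj hc
      obtain ⟨q, d, g1, g2, g3, g4, g5, g6, g7⟩ := ih h' hr hfree' hf'
      -- The tail now runs from `v` to a node `q`, so only the corner at `v` has to be pulled taut.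
      obtain ⟨z, c'', k1, k2, k3, k4, k5, k6, k7⟩ := exists_node_of_triangle _ (Nat.lt_succ_self _)
        hv g2 (cr_trans (mem_NE_iff.1 hv) (mem_NE_iff.1 hr) (mem_NE_iff.1 g2) hf g6) hfree g3 g1
        g5 g4
      refine ⟨z, c'', k1, k2, k3, k4, k5, k6, ?_⟩
      rw [chainLength_cons rfl]; linarith

/-! ### Shortest chains -/

/-- The chain is a shortest CICP. -/
def IsShortest (obs : List Rect) (T p : Point) (c : List Point) : Prop :=
  IsCICP obs T p c ∧ ∀ c', IsCICP obs T p c' → chainLength c ≤ chainLength c'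

/-- A shortest chain starts at least as steeply as any other chain. -/
theorem IsShortest.follows {z d : Point} {c c' : List Point} (hc : IsShortest obs T z c)
    (hc' : IsCICP obs T z c') (hd : Quad d) (hf : Follows d c') : Follows d c := by
  rcases hc.1.cases_edge with ⟨-, rfl⟩ | ⟨v, c₁, rfl, hv, hvf, hvF, hv1⟩
  · trivial
  rcases hc'.cases_edge with ⟨rfl, rfl⟩ | ⟨w, c₂, rfl, hw, hwf, hwF, hw1⟩
  · simpa using hc.1.eq_singleton
  refine cr_trans hd (mem_NE_iff.1 hw) (mem_NE_iff.1 hv) hf ?_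
  -- If the other chain were strictly steeper, the upper chain of the two would be strictly shorter
  -- than the shortest.
  by_contra hneg
  rw [cr_swap, not_le, neg_lt_zero] at hneg
  obtain ⟨x, e, h1, h2, h3, h4, -, -, h7⟩ :=
    exists_upper_chain hv1 hv hw1 hw hwf hwF hneg.le
  have := hc.2 _ (h4.cons h1 h2 h3)
  have h7 := h7 hneg
  rw [chainLength_cons h4.head, chainLength_cons rfl] at this
  linarith

/-! ### The table of stored chains -/

theorem pos_of_cr_nonneg {d e : Point} (hd1 : 0 < d 1) (he : Quad e)
    (h : 0 ≤ cr d e) : 0 < e 1 := by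
  obtain ⟨e0, e1, es⟩ := he
  refine lt_of_le_of_ne e1 fun h1 => ?_
  rw [← h1] at es
  simp only [cr, ← h1] at h
  nlinarith

theorem lt_height_of_cr_nonneg {p v z : Point} (hz : z ∈ NE p)
    (h1 : p 1 < v 1) (h : 0 ≤ cr (v - p) (z - p)) : p 1 < z 1 := by
  have := pos_of_cr_nonneg (by simpa using h1) (mem_NE_iff.1 hz) h
  simpa using this

/-- The first edge of the chain, if any, is not horizontal. -/
def Steep : List Point → Prop
  | p :: q :: _ => p 1 < q 1
  | _ => True

theorem IsCICP.steep {p z : Point} {c : List Point} (h : IsCICP obs T z c)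
    (h1 : p 1 < z 1) (hf : Follows (z - p) c) : Steep c := by
  rcases h.cases_edge with ⟨-, rfl⟩ | ⟨n, c', rfl, hn, -, -, -⟩
  · trivial
  · have := pos_of_cr_nonneg (by simpa using h1) (mem_NE_iff.1 hn) hf
    change z 1 < n 1
    simpa using this

theorem isShortest_singleton : IsShortest obs T T [T] :=
  ⟨isCICP_singleton T, fun c' h => by rw [h.eq_singleton]⟩

/-- The invariant of the loop that fills the table, once the vertices in `done` have been treated. -/
structure TableInv (obs : List Rect) (T : Point) (done : List Point) (tab : List Entry) :
    Prop where
  target : (⟨T, [T], 0⟩ : Entry) ∈ tab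
  node : ∀ e ∈ tab, IsNode obs T e.vertex
  cicp : ∀ e ∈ tab, IsCICP obs T e.vertex e.chain
  len : ∀ e ∈ tab, e.len = chainLength e.chain
  -- This provides the entry of the third vertex when two collinear first edges are merged.
  hook : ∀ e ∈ tab, e.chain = [T] ∨ ∃ e' ∈ tab, e.chain = e.vertex :: e'.chain
  -- A horizontal first edge may lead to a vertex of equal height that is treated later, so
  -- optimality is claimed only if some chain leaves `k` upwards. This suffices: after a rising
  -- edge, convexity excludes a horizontal one.
  shortest : ∀ k ∈ done, (∃ c, IsCICP obs T k c ∧ Steep c) →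
    ∃ e ∈ tab, e.vertex = k ∧ IsShortest obs T k e.chain

/-- A chain from `p` whose second vertex is a node above `p` can be replaced by a segment to a
vertex of the table followed by the stored chain. -/
theorem TableInv.exists_entry {done : List Point} {tab : List Entry}
    (inv : TableInv obs T done tab) {p z : Point} {c : List Point}
    (hdone : ∀ R ∈ obs, p 1 < R.lowerRight 1 → R.lowerRight ∈ done)
    (hz : IsNode obs T z) (hzp : z ∈ NE p) (h1 : p 1 < z 1) (hfree : SegFree obs p z)
    (hf : Follows (z - p) c) (hc : IsCICP obs T z c) :
    ∃ e ∈ tab, IsCICP obs T p (p :: e.chain) ∧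
      dist p e.vertex + e.len ≤ dist p z + chainLength c := by
  obtain ⟨e, he, rfl, hs⟩ : ∃ e ∈ tab, e.vertex = z ∧ IsShortest obs T z e.chain := by
    rcases hz with rfl | ⟨R, hR, rfl⟩
    · exact ⟨_, inv.target, rfl, isShortest_singleton⟩
    · exact inv.shortest _ (hdone R hR h1) ⟨c, hc, hc.steep h1 hf⟩
  refine ⟨e, he, hs.1.cons hzp hfree (hs.follows hc (mem_NE_iff.1 hzp) hf), ?_⟩
  rw [inv.len e he]
  linarith [hs.2 c hc]

theorem mem_candidates {p : Point} {tab : List Entry} {e : Entry} :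
    e ∈ candidates obs T p tab ↔ e ∈ tab ∧ IsCICP obs T p (p :: e.chain) := by
  simp [candidates]

/-- The candidates are at least as good as any chain, if some chain is not horizontal at the
start. -/
theorem TableInv.exists_candidate {done : List Point} {tab : List Entry}
    (inv : TableInv obs T done tab) {l : Point} (hl : l ≠ T)
    (hdone : ∀ R ∈ obs, l 1 < R.lowerRight 1 → R.lowerRight ∈ done)
    {c₀ c : List Point} (h₀ : IsCICP obs T l c₀) (hs : Steep c₀) (hc : IsCICP obs T l c) :
    ∃ e ∈ candidates obs T l tab, e.len + dist e.vertex l ≤ chainLength c := by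
  rcases h₀.cases_edge with ⟨h, -⟩ | ⟨w, c₀', rfl, hw, hwf, hwF, hw'⟩
  · exact absurd h hl
  rcases hc.cases_edge with ⟨h, -⟩ | ⟨v, c', rfl, hv, hvf, hvF, hv'⟩
  · exact absurd h hl
  obtain ⟨x, d, hx, hxf, hxF, hd, hx1, hlen⟩ : ∃ x d, x ∈ NE l ∧ SegFree obs l x ∧
      Follows (x - l) d ∧ IsCICP obs T x d ∧ l 1 < x 1 ∧
      dist l x + chainLength d ≤ dist l v + chainLength (v :: c') := by
    -- If `c` starts flatter than the steep chain, it is replaced by the upper chain of the two;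
    -- otherwise it rises itself. Either way the second vertex is strictly above `l`.
    rcases le_total 0 (cr (v - l) (w - l)) with h | h
    · obtain ⟨x, d, g1, g2, g3, g4, g5, g6, -⟩ := exists_upper_chain hv' hv hw' hw hwf hwF h
      exact ⟨x, d, g1, g2, g3, g4, lt_height_of_cr_nonneg g1 hs g5, g6⟩
    · exact ⟨v, v :: c', hv, hvf, hvF, hv',
        lt_height_of_cr_nonneg hv hs (by rw [cr_swap]; linarith), le_rfl⟩
  obtain ⟨z, d', k1, k2, k3, k4, k5, k6, k7⟩ := exists_node_chain hd hx hxf hxF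
  obtain ⟨e, he, he1, he2⟩ :=
    inv.exists_entry hdone k1 k2 (lt_height_of_cr_nonneg k2 hx1 k6) k3 k4 k5
  refine ⟨e, mem_candidates.2 ⟨he, he1⟩, ?_⟩
  rw [chainLength_cons rfl, dist_comm e.vertex]
  linarith

/-- Some candidate is at least as good as any given chain, so the minimizing one is shortest. A
vertex that coincides with `T` is served by the initial entry. -/
theorem TableInv.update {done : List Point} {tab : List Entry}
    (inv : TableInv obs T done tab) {l : Point} (hlR : ∃ R ∈ obs, l = R.lowerRight)
    (hdone : ∀ R ∈ obs, l 1 < R.lowerRight 1 → R.lowerRight ∈ done) :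
    TableInv obs T (done ++ [l]) (update obs T tab l) := by
  unfold PVA.update
  split
  · rename_i h
    rw [List.argmin_eq_none] at h
    refine ⟨inv.target, inv.node, inv.cicp, inv.len, inv.hook, ?_⟩
    rintro k hk ⟨c, hc, hs⟩
    rcases List.mem_append.1 hk with hk | hk
    · exact inv.shortest k hk ⟨c, hc, hs⟩
    · rw [List.mem_singleton] at hk
      subst hk
      by_cases hl : k = T
      · exact ⟨_, inv.target, hl.symm, by rw [hl]; exact isShortest_singleton⟩
      · obtain ⟨e, he, -⟩ := inv.exists_candidate hl hdone hc hs hc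
        simp [h] at he
  · rename_i e h
    have hmem := List.argmin_mem h
    obtain ⟨heT, hec⟩ := mem_candidates.1 hmem
    have hlen : e.len + dist e.vertex l = chainLength (l :: e.chain) := by
      rw [chainLength_cons (inv.cicp e heT).head, inv.len e heT, dist_comm, add_comm]
    refine ⟨?_, ?_, ?_, ?_, ?_, ?_⟩
    · exact List.mem_append_left _ inv.target
    · intro x hx
      rcases List.mem_append.1 hx with hx | hx
      · exact inv.node x hx
      · rw [List.mem_singleton.1 hx]; exact Or.inr hlR
    · intro x hx
      rcases List.mem_append.1 hx with hx | hx
      · exact inv.cicp x hx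
      · rw [List.mem_singleton.1 hx]; exact hec
    · intro x hx
      rcases List.mem_append.1 hx with hx | hx
      · exact inv.len x hx
      · rw [List.mem_singleton.1 hx]; exact hlen
    · intro x hx
      rcases List.mem_append.1 hx with hx | hx
      · rcases inv.hook x hx with h | ⟨e', he', h⟩
        · exact Or.inl h
        · exact Or.inr ⟨e', List.mem_append_left _ he', h⟩
      · rw [List.mem_singleton.1 hx]
        exact Or.inr ⟨e, List.mem_append_left _ heT, rfl⟩
    · rintro k hk ⟨c, hc, hs⟩
      rcases List.mem_append.1 hk with hk | hk
      · obtain ⟨e', he', h⟩ := inv.shortest k hk ⟨c, hc, hs⟩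
        exact ⟨e', List.mem_append_left _ he', h⟩
      · rw [List.mem_singleton] at hk
        subst hk
        by_cases hl : k = T
        · exact ⟨_, List.mem_append_left _ inv.target, hl.symm,
            by rw [hl]; exact isShortest_singleton⟩
        · refine ⟨_, List.mem_append_right _ (List.mem_singleton_self _), rfl, hec,
            fun c' hc' => ?_⟩
          obtain ⟨e', he', hle⟩ := inv.exists_candidate hl hdone hc hs hc'
          change chainLength (k :: e.chain) ≤ _
          rw [← hlen]
          exact (List.le_of_mem_argmin he' h).trans hle

/-- By the order of heights, a vertex strictly above the current one has already been treated. -/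
theorem TableInv.foldl (rest : List Point) : ∀ {done : List Point} {tab : List Entry},
    TableInv obs T done tab → (∀ k ∈ rest, ∃ R ∈ obs, k = R.lowerRight) →
    (∀ R ∈ obs, R.lowerRight ∈ done ++ rest) →
    (done ++ rest).Pairwise (fun p q => q 1 ≤ p 1) →
    TableInv obs T (done ++ rest) (rest.foldl (PVA.update obs T) tab) := by
  induction rest with
  | nil => intro done tab inv _ _ _; simpa using inv
  | cons l rest ih =>
    intro done tab inv h1 h2 h3
    have hstep := inv.update (h1 l List.mem_cons_self) fun R hR hlt => by
      rcases List.mem_append.1 (h2 R hR) with h | h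
      · exact h
      · rcases List.mem_cons.1 h with h | h
        · rw [h] at hlt; exact absurd hlt (lt_irrefl _)
        · have := (List.pairwise_cons.1 (List.pairwise_append.1 h3).2.1).1 _ h
          linarith
    have := ih hstep (fun k hk => h1 k (List.mem_cons_of_mem _ hk))
      (by simpa using h2) (by simpa using h3)
    simpa using this

theorem tableInv_table (obs : List Rect) (T : Point) :
    TableInv obs T (sortedLowerRight obs) (table obs T) := by
  have hperm := List.mergeSort_perm (obs.map Rect.lowerRight) (fun p q => decide (q 1 ≤ p 1))
  have hsort : (sortedLowerRight obs).Pairwise (fun p q => q 1 ≤ p 1) := by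
    have := List.pairwise_mergeSort (le := fun p q : Point => decide (q 1 ≤ p 1))
      (fun a b c h1 h2 => by simp only [decide_eq_true_eq] at *; linarith)
      (fun a b => by simpa using le_total (b 1) (a 1)) (obs.map Rect.lowerRight)
    simpa [sortedLowerRight] using this
  have h0 : TableInv obs T [] [⟨T, [T], 0⟩] := by
    refine ⟨by simp, ?_, ?_, ?_, ?_, by simp⟩ <;> intro e he <;> rw [List.mem_singleton.1 he]
    · exact Or.inl rfl
    · exact isCICP_singleton T
    · rfl
    · exact Or.inl rfl
  have := TableInv.foldl (sortedLowerRight obs) h0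
    (fun k hk => by
      obtain ⟨R, hR, h⟩ := List.mem_map.1 (hperm.mem_iff.1 hk)
      exact ⟨R, hR, h.symm⟩)
    (fun R hR => by
      rw [List.nil_append]
      exact hperm.mem_iff.2 (List.mem_map_of_mem hR))
    (by simpa using hsort)
  rw [List.nil_append] at this
  exact this

/-- Below all obstacles the table yields a chain that is not longer than a given one. -/
theorem IsCICP.exists_entry {p : Point} {c : List Point} (hp : ∀ k, IsNode obs T k → p 1 < k 1)
    (h : IsCICP obs T p c) :
    ∃ e ∈ table obs T, IsCICP obs T p (p :: e.chain) ∧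
      dist p e.vertex + e.len ≤ chainLength c := by
  have inv := tableInv_table obs T
  rcases h.cases_edge with ⟨h, -⟩ | ⟨v, c', rfl, hv, hvf, hvF, hv'⟩
  · have := hp T (Or.inl rfl)
    rw [h] at this
    exact absurd this (lt_irrefl _)
  obtain ⟨z, d', k1, k2, k3, k4, k5, k6, k7⟩ := exists_node_chain hv' hv hvf hvF
  obtain ⟨e, he, he1, he2⟩ := inv.exists_entry (p := p) (fun R hR _ =>
    (List.mergeSort_perm _ _).mem_iff.2 (List.mem_map_of_mem hR)) k1 k2 (hp z k1) k3 k4 k5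
  refine ⟨e, he, he1, ?_⟩
  rw [chainLength_cons rfl]
  linarith

variable {L t : ℝ}

/-! ### Points of the take-off line -/

/-- The point of the line `y = t` with abscissa `x`. -/
def pt (t x : ℝ) : Point := !₂[x, t]

@[simp] theorem pt_zero (t x : ℝ) : pt t x 0 = x := rfl

@[simp] theorem pt_one (t x : ℝ) : pt t x 1 = t := rfl

theorem eq_pt {A : Point} (h : A 1 = t) : A = pt t (A 0) := ext_coord rfl h

theorem continuous_pt (t : ℝ) : Continuous (pt t) := by
  unfold pt
  fun_prop

theorem dist_sq (p q : Point) : dist p q ^ 2 = (p 0 - q 0) ^ 2 + (p 1 - q 1) ^ 2 := by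
  rw [EuclideanSpace.dist_eq, Real.sq_sqrt (Finset.sum_nonneg fun i _ => sq_nonneg _),
    Fin.sum_univ_two, Real.dist_eq, Real.dist_eq, sq_abs, sq_abs]

theorem dist_lt_of_right {p p' q : Point} (h1 : p 1 = p' 1) (h : p 0 < p' 0) (h' : p' 0 ≤ q 0) :
    dist p' q < dist p q := by
  refine lt_of_pow_lt_pow_left₀ 2 dist_nonneg ?_
  rw [dist_sq, dist_sq, h1]
  nlinarith

theorem isOpen_inside (R : Rect) : IsOpen R.inside := by
  have h0 : Continuous fun p : Point => p 0 := by fun_prop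
  have h1 : Continuous fun p : Point => p 1 := by fun_prop
  exact (isOpen_lt continuous_const h0).inter ((isOpen_lt h0 continuous_const).inter
    ((isOpen_lt continuous_const h1).inter (isOpen_lt h1 continuous_const)))

/-- Obstacles are open, so for each fixed parameter along the segment the avoidance condition is
closed in `x`. -/
theorem isClosed_segFree (obs : List Rect) (t : ℝ) (v : Point) :
    IsClosed {x | SegFree obs (pt t x) v} := by
  have : {x | SegFree obs (pt t x) v} = ⋂ R ∈ obs, ⋂ τ ∈ Set.Icc (0 : ℝ) 1,
      {x | pt t x + τ • (v - pt t x) ∈ R.inside}ᶜ := by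
    ext x
    simp only [SegFree, Set.disjoint_left, mem_segment_iff, Set.mem_iInter, Set.mem_compl_iff,
      Set.mem_ofPred_eq, Set.mem_Icc]
    constructor
    · intro h R hR τ hτ
      exact h R hR ⟨τ, hτ.1, hτ.2, rfl⟩
    · rintro h R hR _ ⟨τ, h0, h1, rfl⟩
      exact h R hR τ ⟨h0, h1⟩
  rw [this]
  have hc := continuous_pt t
  refine isClosed_biInter fun R _ => isClosed_biInter fun τ _ => IsOpen.isClosed_compl ?_
  exact (isOpen_inside R).preimage (by fun_prop)

theorem continuous_cr_sub_pt (t : ℝ) (v d : Point) : Continuous fun x => cr (v - pt t x) d := by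
  simp only [cr, PiLp.sub_apply, pt_zero, pt_one]
  fun_prop

theorem isClosed_follows (t : ℝ) (v : Point) (c : List Point) :
    IsClosed {x | Follows (v - pt t x) c} := by
  match c with
  | [] => exact isClosed_univ
  | [_] => exact isClosed_univ
  | p :: q :: _ => exact isClosed_le continuous_const (continuous_cr_sub_pt t v _)

theorem mem_NE_pt_iff {x : ℝ} {v : Point} (hv : t < v 1) : v ∈ NE (pt t x) ↔ x ≤ v 0 := by
  refine ⟨fun h => h.1, fun h => ⟨h, hv.le, ?_⟩⟩
  rintro rfl
  exact lt_irrefl _ hv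

/-- The abscissas from which the chain stored in `e` is reached within length `L`. -/
def reach (obs : List Rect) (T : Point) (L t : ℝ) (e : Entry) : Set ℝ :=
  {x | IsCICP obs T (pt t x) (pt t x :: e.chain) ∧ dist (pt t x) e.vertex + e.len ≤ L}

theorem isClosed_reach {e : Entry} (hN : ∀ k, IsNode obs T k → t < k 1)
    (he : e ∈ table obs T) : IsClosed (reach obs T L t e) := by
  have inv := tableInv_table obs T
  have hv := hN _ (inv.node e he)
  have hc := inv.cicp e he
  have : reach obs T L t e = {x | x ≤ e.vertex 0} ∩ ({x | SegFree obs (pt t x) e.vertex} ∩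
      ({x | Follows (e.vertex - pt t x) e.chain} ∩
        {x | dist (pt t x) e.vertex + e.len ≤ L})) := by
    ext x
    simp only [reach, Set.mem_inter_iff, Set.mem_ofPred_eq, isCICP_cons_iff hc.head,
      mem_NE_pt_iff hv, hc, and_true, and_assoc]
  rw [this]
  have hp := continuous_pt t
  exact (isClosed_le continuous_id continuous_const).inter ((isClosed_segFree obs t _).inter
    ((isClosed_follows t _ _).inter (isClosed_le (by fun_prop) continuous_const)))

theorem chainLength_entry {e : Entry} (he : e ∈ table obs T) (p : Point) :
    chainLength (p :: e.chain) = dist p e.vertex + e.len := by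
  have inv := tableInv_table obs T
  rw [chainLength_cons (inv.cicp e he).head, inv.len e he]

theorem pVisible_pt_iff (hN : ∀ k, IsNode obs T k → t < k 1) {x : ℝ} :
    PVisible obs T L (pt t x) ↔ ∃ e ∈ table obs T, x ∈ reach obs T L t e := by
  constructor
  · rintro ⟨c, hc, hlen⟩
    obtain ⟨e, he, h1, h2⟩ := hc.exists_entry (fun k hk => hN k hk)
    exact ⟨e, he, h1, h2.trans hlen⟩
  · rintro ⟨e, he, h1, h2⟩
    exact ⟨_, h1, by rwa [chainLength_entry he]⟩

theorem isClosed_visible (hN : ∀ k, IsNode obs T k → t < k 1) :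
    IsClosed {x | PVisible obs T L (pt t x)} := by
  have : {x | PVisible obs T L (pt t x)} =
      ⋃ e ∈ {e | e ∈ table obs T}, reach obs T L t e := by
    ext x
    simp only [Set.mem_ofPred_eq, pVisible_pt_iff hN, Set.mem_iUnion, exists_prop]
  rw [this]
  exact (table obs T).finite_toSet.isClosed_biUnion fun e he => isClosed_reach hN he

theorem PVisible.le_target {Y : Point} (h : PVisible obs T L Y) : Y 0 ≤ T 0 := by
  obtain ⟨c, hc, -⟩ := h
  exact hc.le_end.1

theorem PVisible.ge_of_dist_eq {Q Y : Point} (hQ : dist Q T = L) (h1 : Y 1 = Q 1)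
    (h : PVisible obs T L Y) (hQT : Q 0 ≤ T 0) : Q 0 ≤ Y 0 := by
  obtain ⟨c, hc, hlen⟩ := h
  by_contra hlt
  have := dist_lt_of_right (q := T) h1 (not_le.1 hlt) hQT
  linarith [hc.dist_le]

/-- The vertical segment up to `T` at most touches obstacles. Thus every gap has a visible point to
its right. -/
theorem pVisible_below_target (hl : ∀ R ∈ obs, R.right ≤ T 0) (hT : t < T 1)
    (hL : T 1 - t ≤ L) : PVisible obs T L (pt t (T 0)) := by
  refine ⟨[pt t (T 0), T], (isCICP_singleton T).cons ((mem_NE_pt_iff hT).2 le_rfl) ?_ trivial, ?_⟩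
  · intro R hR
    rw [Set.disjoint_left]
    intro m hm hmR
    have := (sub_coord_of_mem_segment ((mem_NE_pt_iff hT).2 le_rfl) hm).1
    have := hmR.2.1
    have := hl R hR
    simp only [pt_zero] at *
    linarith
  · simp only [chainLength, add_zero]
    refine le_trans (le_of_eq ?_) hL
    rw [← abs_of_pos (sub_pos.2 hT), ← abs_of_nonneg (dist_nonneg (x := pt t (T 0)) (y := T)),
      ← sq_eq_sq_iff_abs_eq_abs, dist_sq]
    simp only [pt_zero, pt_one]; ring

/-! ### Right end-points -/

theorem rightEnds_height {B : Point} (h : B ∈ rightEnds obs T L t) : B 1 = t := by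
  obtain ⟨_, _, h, _⟩ := h
  exact h

theorem rightEnds_visible {B : Point} (h : B ∈ rightEnds obs T L t) : PVisible obs T L B := by
  obtain ⟨e, he, -, -, hd, hc, -⟩ := h
  exact ⟨_, hc, by rw [chainLength_entry he, hd]; linarith⟩

/-- A chain of length less than `L` from `x` could be prolonged by a short horizontal edge to the
left, which is below all obstacles and keeps the chain convex. So every chain has length at least
`L`. -/
theorem mem_rightEnds (hN : ∀ k, IsNode obs T k → t < k 1) (hb : ∀ R ∈ obs, t < R.bot)
    {x y : ℝ} (hx : PVisible obs T L (pt t x)) (hyx : y < x)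
    (hy : ∀ z, y < z → z < x → ¬ PVisible obs T L (pt t z)) : pt t x ∈ rightEnds obs T L t := by
  have hlen : ∀ c, IsCICP obs T (pt t x) c → L ≤ chainLength c := by
    intro c hc
    by_contra hlt
    rw [not_le] at hlt
    -- The first bound keeps `x - ε` in the gap, the second keeps the length within `L`.
    set ε := min ((x - y) / 2) (L - chainLength c) with hε
    have hε0 : 0 < ε := lt_min (by linarith) (by linarith)
    have hε1 : ε ≤ (x - y) / 2 := min_le_left _ _
    have hε2 : ε ≤ L - chainLength c := min_le_right _ _
    have hNE : pt t x ∈ NE (pt t (x - ε)) := by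
      rw [mem_NE_iff]
      refine ⟨?_, ?_, ?_⟩ <;> simp <;> linarith
    refine hy (x - ε) (by linarith) (by linarith) ⟨_, hc.cons hNE ?_ ?_, ?_⟩
    · intro R hR
      rw [Set.disjoint_left]
      intro m hm hmR
      have h1 := (sub_coord_of_mem_segment hNE hm).2.2.2
      have := hmR.2.2.1
      have := hb R hR
      rw [pt_one] at h1
      linarith
    · rcases hc.cases_edge with ⟨-, rfl⟩ | ⟨q, c', rfl, hq, -⟩
      · trivial
      · change 0 ≤ cr _ _
        have := hq.2.1
        rw [pt_one] at this
        simp only [cr, PiLp.sub_apply, pt_zero, pt_one]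
        nlinarith
    · rw [chainLength_cons hc.head]
      have : dist (pt t (x - ε)) (pt t x) = ε := by
        rw [← abs_of_pos hε0, ← abs_of_nonneg (dist_nonneg (x := pt t (x - |ε|)) (y := pt t x)),
          ← sq_eq_sq_iff_abs_eq_abs, dist_sq, abs_of_pos hε0]
        simp only [pt_zero, pt_one]; ring
      linarith
  obtain ⟨e, he, h1, h2⟩ := (pVisible_pt_iff hN).1 hx
  have h3 := hlen _ h1
  rw [chainLength_entry he] at h3
  refine ⟨e, he, rfl, ?_, by linarith, h1, ?_⟩
  · exact ((isCICP_cons_iff ((tableInv_table obs T).cicp e he).head).1 h1).1.1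
  · rintro ⟨e', -, h4, h5⟩
    linarith [hlen _ h4]

/-- Otherwise one entry of the finite table serves points arbitrarily close to `x` on the left, and
by closedness also `x`. From `x` it is strictly closer, so its chain has length less than `L`, which
a right end-point forbids. -/
theorem exists_not_visible_left (hN : ∀ k, IsNode obs T k → t < k 1) {x y : ℝ}
    (hB : pt t x ∈ rightEnds obs T L t) (hyx : y < x) :
    ∃ z, y < z ∧ z < x ∧ ¬ PVisible obs T L (pt t z) := by
  by_contra hcon
  push Not at hcon
  obtain ⟨e, he, hfreq⟩ : ∃ e ∈ table obs T, ∃ᶠ z in 𝓝[<] x, z ∈ reach obs T L t e := by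
    by_contra hno
    push Not at hno
    have hall : ∀ᶠ z in 𝓝[<] x, ∀ e ∈ {e | e ∈ table obs T}, z ∉ reach obs T L t e :=
      ((table obs T).finite_toSet.eventually_all).2 hno
    obtain ⟨z, hz1, hz2⟩ := (hall.and (Ioo_mem_nhdsLT hyx)).exists
    obtain ⟨e, he, hz⟩ := (pVisible_pt_iff hN).1 (hcon z hz2.1 hz2.2)
    exact hz1 e he hz
  have hx : x ∈ reach obs T L t e := (isClosed_reach hN he).mem_of_frequently_of_tendsto hfreq
    (tendsto_id.mono_left nhdsWithin_le_nhds)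
  obtain ⟨z, hz1, hz2⟩ := (hfreq.and_eventually self_mem_nhdsWithin).exists
  obtain ⟨_, _, _, _, _, _, hno⟩ := hB
  have hle := ((isCICP_cons_iff ((tableInv_table obs T).cicp e he).head).1 hx.1).1.1
  have := dist_lt_of_right (p := pt t z) (p' := pt t x) (q := e.vertex) rfl hz2 hle
  refine hno ⟨e, he, hx.1, ?_⟩
  rw [chainLength_entry he]
  linarith [hz1.2]

/-! ### Left end-points -/

/-- If the segment from `(a, t)` to `v` does not cross the obstacle, but segments that start
slightly to the right do, then the upper-left vertex of the obstacle is on the segment. -/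
theorem eventually_disjoint_inside {R : Rect} {a : ℝ} {v : Point} (hv : t < v 1)
    (hav : a < v 0) (hdis : Disjoint (segment ℝ (pt t a) v) R.inside)
    (hu : ¬ (R.upperLeft ∈ segment ℝ (pt t a) v ∧ R.upperLeft 1 < v 1)) :
    ∀ᶠ x in 𝓝[>] a, Disjoint (segment ℝ (pt t x) v) R.inside := by
  have hV : 0 < v 1 - t := by linarith
  have hW : 0 < v 0 - a := by linarith
  set τu := (R.top - t) / (v 1 - t) with hτu
  have hτu0 : τu * (v 1 - t) = R.top - t := div_mul_cancel₀ _ hV.ne'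
  have hfree : ∀ τ : ℝ, 0 ≤ τ → τ ≤ 1 → R.left < a + τ * (v 0 - a) →
      a + τ * (v 0 - a) < R.right → R.bot < t + τ * (v 1 - t) → R.top ≤ t + τ * (v 1 - t) := by
    intro τ h0 h1 h2 h3 h4
    by_contra h5
    refine Set.disjoint_left.1 hdis (mem_segment_iff.2 ⟨τ, h0, h1, rfl⟩) ⟨?_, ?_, ?_, ?_⟩ <;>
      simp <;> linarith
  -- Points with equal parameter on the two segments have equal height. At a collision of the
  -- shifted segment, the original one is therefore not yet past the left side.
  have hcol : ∀ x, a < x → x < v 0 → ¬ Disjoint (segment ℝ (pt t x) v) R.inside →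
      ∃ τ : ℝ, 0 ≤ τ ∧ τ < 1 ∧ τ < τu ∧ a + τ * (v 0 - a) ≤ R.left ∧
        R.left < a + τ * (v 0 - a) + (1 - τ) * (x - a) ∧ R.bot < t + τ * (v 1 - t) := by
    intro x hx hxv h
    rw [Set.not_disjoint_iff] at h
    obtain ⟨m, hm, hmR⟩ := h
    obtain ⟨τ, h0, h1, rfl⟩ := mem_segment_iff.1 hm
    obtain ⟨g1, g2, g3, g4⟩ := hmR
    simp only [PiLp.add_apply, PiLp.sub_apply, PiLp.smul_apply, smul_eq_mul, pt_zero, pt_one]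
      at g1 g2 g3 g4
    have hle : a + τ * (v 0 - a) ≤ R.left := by
      by_contra hlt
      have := hfree τ h0 h1 (by linarith)
        (by nlinarith [mul_nonneg (sub_nonneg.2 h1) (sub_nonneg.2 hx.le)]) g3
      linarith
    refine ⟨τ, h0, lt_of_le_of_ne h1 ?_, ?_, hle, by linarith, g3⟩
    · rintro rfl
      linarith
    · by_contra hlt
      nlinarith
  have hnear : ∀ᶠ x in 𝓝[>] a, a < x ∧ x < v 0 := Ioo_mem_nhdsGT hav
  -- At the height of the top side, the original segment is either strictly left of the obstacle,
  -- which leaves room for a small shift, or has reached the left side.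
  rcases lt_or_ge (a + τu * (v 0 - a)) R.left with hA | hA
  · have hev : ∀ᶠ x in 𝓝[>] a, x < a + (R.left - (a + τu * (v 0 - a))) :=
      mem_of_superset (Ioo_mem_nhdsGT (by linarith)) fun x hx => hx.2
    filter_upwards [hnear, hev] with x hx hx'
    by_contra hno
    obtain ⟨τ, h0, h1, h2, h3, h4, h5⟩ := hcol x hx.1 hx.2 hno
    nlinarith [mul_nonneg h0 (sub_nonneg.2 hx.1.le)]
  · filter_upwards [hnear] with x hx
    by_contra hno
    obtain ⟨τ, h0, h1, h2, h3, h4, h5⟩ := hcol x hx.1 hx.2 hno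
    set σ := (R.left - a) / (v 0 - a) with hσ
    have hσ0 : σ * (v 0 - a) = R.left - a := div_mul_cancel₀ _ hW.ne'
    have hτσ : τ ≤ σ := by
      rw [hσ, le_div_iff₀ hW]; linarith
    have hσ1 : σ < 1 := by
      rw [hσ, div_lt_one hW]
      nlinarith [mul_lt_mul_of_pos_left (sub_lt_sub_right hx.2 a) (sub_pos.2 h1)]
    have hσu : σ ≤ τu := by
      rw [hσ, div_le_iff₀ hW]; linarith
    -- The left side is reached at parameter `σ`: exactly at the top this is the excluded upper-left
    -- vertex; below it the original segment enters the obstacle just after `σ`.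
    rcases hσu.eq_or_lt with he | hlt
    · refine hu ⟨mem_segment_iff.2 ⟨σ, h0.trans hτσ, hσ1.le, ext_coord ?_ ?_⟩, ?_⟩
      · simp [Rect.upperLeft]; linarith
      · simp [Rect.upperLeft]; rw [he]; linarith
      · simp only [Rect.upperLeft, PiLp.toLp_apply, Matrix.cons_val_one, Matrix.cons_val_fin_one]
        rw [he] at hσ1
        nlinarith
    · have hρ : σ < min (min 1 τu) ((R.right - a) / (v 0 - a)) := by
        refine lt_min (lt_min hσ1 hlt) ?_
        rw [hσ, div_lt_div_iff_of_pos_right hW]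
        linarith [R.left_lt_right]
      obtain ⟨τ', k1, k2⟩ := exists_between hρ
      have k3 : τ' < 1 := k2.trans_le ((min_le_left _ _).trans (min_le_left _ _))
      have k4 : τ' < τu := k2.trans_le ((min_le_left _ _).trans (min_le_right _ _))
      have k5 : τ' < (R.right - a) / (v 0 - a) := k2.trans_le (min_le_right _ _)
      rw [lt_div_iff₀ hW] at k5
      have := hfree τ' (by linarith) k3.le (by nlinarith) (by linarith) (by nlinarith)
      nlinarith

theorem eventually_follows {a : ℝ} {v : Point} {c : List Point}
    (h : ∀ p q c', c = p :: q :: c' → 0 < cr (v - pt t a) (q - p)) :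
    ∀ᶠ x in 𝓝[>] a, Follows (v - pt t x) c := by
  match c, h with
  | [], _ => exact Eventually.of_forall fun _ => trivial
  | [_], _ => exact Eventually.of_forall fun _ => trivial
  | p :: q :: _, h =>
    have := (continuous_cr_sub_pt t v (q - p)).continuousAt.eventually_const_lt (h p q _ rfl)
    exact (this.filter_mono nhdsWithin_le_nhds).mono fun x hx => hx.le

/-- The table contains the tail of a shortest chain from `p` that turns strictly at its second
vertex. -/
theorem exists_shortest_entry {p : Point} (hp : ∀ k, IsNode obs T k → p 1 < k 1) {c : List Point}
    (hc : IsCICP obs T p c) :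
    ∃ e ∈ table obs T, IsShortest obs T p (p :: e.chain) ∧
      ∀ v n c', e.chain = v :: n :: c' → 0 < cr (e.vertex - p) (n - v) := by
  have inv := tableInv_table obs T
  have hfin := (table obs T).finite_toSet
  obtain ⟨e₀, h₀, hmin⟩ := Set.exists_min_image
    {e | e ∈ table obs T ∧ IsCICP obs T p (p :: e.chain)}
    (fun e => dist p e.vertex + e.len) (hfin.subset fun e he => he.1)
    (by
      obtain ⟨e, he, h, -⟩ := hc.exists_entry hp
      exact ⟨e, he, h⟩)
  have hs₀ : IsShortest obs T p (p :: e₀.chain) := by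
    refine ⟨h₀.2, fun c' hc' => ?_⟩
    obtain ⟨e, he, h, hle⟩ := hc'.exists_entry hp
    rw [chainLength_entry h₀.1]
    exact (hmin e ⟨he, h⟩).trans hle
  -- Among the shortest choices the one with the highest second vertex is taken: if it did not turn
  -- there, merging the two edges would give a higher one.
  obtain ⟨e, ⟨he, hs⟩, hmax⟩ := Set.exists_max_image
    {e | e ∈ table obs T ∧ IsShortest obs T p (p :: e.chain)}
    (fun e => e.vertex 1) (hfin.subset fun e he => he.1) ⟨e₀, h₀.1, hs₀⟩
  refine ⟨e, he, hs, fun v n c' hch => ?_⟩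
  have hcv := inv.cicp e he
  obtain ⟨hvNE, hvfree, hvF, -⟩ := (isCICP_cons_iff hcv.head).1 hs.1
  obtain rfl : v = e.vertex := by
    have := hcv.head
    rw [hch] at this
    simpa using this
  rw [hch] at hvF hcv
  obtain ⟨hn, hnfree, hnF, hncicp⟩ := (isCICP_cons_iff rfl).1 hcv
  refine lt_of_le_of_ne hvF fun h0 => ?_
  obtain ⟨s, hs0, hsn⟩ :=
    exists_smul_of_cr_eq_zero (mem_NE_iff.1 hvNE) (mem_NE_iff.1 hn) h0.symm
  rcases inv.hook e he with h | ⟨e', he', h⟩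
  · rw [hch] at h; simp at h
  rw [hch, List.cons.injEq] at h
  have hev : e'.vertex = n := by
    have := (inv.cicp e' he').head
    rw [← h.2] at this
    simpa using this.symm
  have hnp : n - p = (1 + s) • (e.vertex - p) := by
    rw [add_smul, one_smul, ← hsn]; abel
  have hmem : e.vertex ∈ segment ℝ p n := by
    refine mem_segment_iff.2 ⟨(1 + s)⁻¹, by positivity, inv_le_one_of_one_le₀ (by linarith), ?_⟩
    rw [hnp, smul_smul, inv_mul_cancel₀ (by positivity), one_smul]; abel
  have hnp' : n - p = ((1 + s) / s) • (n - e.vertex) := by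
    rw [hnp, hsn, smul_smul, div_mul_cancel₀ _ hs0.ne']
  have hc' : IsCICP obs T p (p :: n :: c') := hncicp.cons (NE_trans hvNE hn)
    (hvfree.union hnfree hmem) (by rw [hnp']; exact hnF.smul (by positivity))
  have hlen : chainLength (p :: n :: c') = chainLength (p :: e.vertex :: n :: c') := by
    change dist p n + chainLength (n :: c') =
      dist p e.vertex + (dist e.vertex n + chainLength (n :: c'))
    rw [← dist_add_dist_of_mem hmem]
    ring
  have hs' : IsShortest obs T p (p :: e'.chain) := by
    rw [← h.2]
    refine ⟨hc', fun d hd => ?_⟩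
    rw [hlen, ← hch]
    exact hs.2 d hd
  have hle : e'.vertex 1 ≤ e.vertex 1 := hmax e' ⟨he', hs'⟩
  rw [hev] at hle
  have h1 := congrArg (fun z : Point => z 1) hsn
  have h2 := hp _ (inv.node e he)
  simp only [PiLp.sub_apply, PiLp.smul_apply, smul_eq_mul] at h1
  nlinarith

/-- A shortest chain passes through the upper-left vertex `u` of an obstacle on its first edge: then
its second vertex is a best choice for `u`. -/
theorem IsShortest.isBest {p u : Point} {e : Entry} (he : e ∈ table obs T)
    (hs : IsShortest obs T p (p :: e.chain)) (hu : u ∈ segment ℝ p e.vertex)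
    (hpv : p 0 < e.vertex 0) (hpu : p 1 < u 1) (huv : u 1 < e.vertex 1) :
    IsBest obs T u e := by
  have inv := tableInv_table obs T
  have hc := inv.cicp e he
  obtain ⟨hNE, hfree, hF, -⟩ := (isCICP_cons_iff hc.head).1 hs.1
  obtain ⟨τ, h0, h1, e1, e2⟩ := cr_sub_of_mem_segment hu
  have hQ := mem_NE_iff.1 hNE
  have hτ0 : 0 < τ := by
    refine lt_of_le_of_ne h0 fun h => ?_
    rw [← h, zero_smul, sub_eq_zero] at e1
    rw [e1] at hpu
    exact lt_irrefl _ hpu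
  have hτ1 : 0 < 1 - τ := by
    refine lt_of_le_of_ne (by linarith) fun h => ?_
    rw [← h, zero_smul, sub_eq_zero] at e2
    rw [e2] at huv
    exact lt_irrefl _ huv
  have huNE : u ∈ NE p := by rw [mem_NE_iff, e1]; exact hQ.smul hτ0
  have hvNE : e.vertex ∈ NE u := by rw [mem_NE_iff, e2]; exact hQ.smul hτ1
  have hdir : u - p = (τ / (1 - τ)) • (e.vertex - u) := by
    rw [e1, e2, smul_smul, div_mul_cancel₀ _ hτ1.ne']
  refine ⟨mem_candidates.2 ⟨he, hc.cons hvNE (hfree.mono hu (right_mem_segment ℝ _ _))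
    (by rw [e2]; exact hF.smul hτ1.le)⟩, fun e' he' => ?_⟩
  obtain ⟨he'T, he'c⟩ := mem_candidates.1 he'
  have hc' := inv.cicp e' he'T
  obtain ⟨hNE', hfree', hF', -⟩ := (isCICP_cons_iff hc'.head).1 he'c
  -- A steeper candidate would give a strictly shorter chain from `u`, and also from `p`, since `pu`
  -- has the same direction as the rest of the edge.
  have hcr : 0 ≤ cr (e'.vertex - u) (e.vertex - u) := by
    by_contra hneg
    rw [cr_swap, not_le, neg_lt_zero] at hneg
    obtain ⟨z, c, g1, g2, g3, g4, g5, -, g7⟩ :=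
      exists_upper_chain hc hvNE hc' hNE' hfree' hF' hneg.le
    have hup : IsCICP obs T p (p :: u :: c) := (g4.cons g1 g2 g3).cons huNE
      (hfree.mono (left_mem_segment ℝ _ _) hu) (by
        obtain ⟨c0, rfl⟩ := g4.exists_eq_cons
        change 0 ≤ cr _ _
        rw [hdir, cr_smul_left]
        exact mul_nonneg (by positivity) (cr_trans (mem_NE_iff.1 hvNE) (mem_NE_iff.1 hNE')
          (mem_NE_iff.1 g1) hneg.le g5))
    have h3 := hs.2 _ hup
    have h4 := g7 hneg
    rw [chainLength_cons hc.head, chainLength_cons rfl, chainLength_cons g4.head,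
      ← dist_add_dist_of_mem hu] at h3
    linarith
  simp only [slopeOf]
  -- For a vertical edge `slopeOf` is 0 through division by zero, and a nonnegative slope of `e` is
  -- enough.
  rcases hNE'.1.eq_or_lt with h | h
  · rw [← h, sub_self, div_zero]
    exact div_nonneg (sub_nonneg.2 hvNE.2.1) (sub_nonneg.2 hvNE.1)
  · simp only [cr, PiLp.sub_apply] at hcr
    have h' : 0 < e.vertex 0 - u 0 := by
      have h1 := congrArg (fun z : Point => z 0) e2
      simp only [PiLp.sub_apply, PiLp.smul_apply, smul_eq_mul] at h1
      rw [h1]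
      exact mul_pos hτ1 (sub_pos.2 hpv)
    rw [div_le_div_iff₀ (by linarith) h']
    linarith

theorem leftEnds_height {A : Point} (h : A ∈ leftEnds obs T L t) : A 1 = t := by
  obtain ⟨_, _, _, _, h, _⟩ := h
  exact h

/-- `A` is below `u` on the line, so `e.vertex - A` is a positive multiple of `e.vertex - u` and
convexity is inherited. -/
theorem leftEnds_visible (hb : ∀ R ∈ obs, t < R.bot) {A : Point}
    (h : A ∈ leftEnds obs T L t) : PVisible obs T L A := by
  obtain ⟨R, hR, e, hbest, hA1, hA, hlen, hfree⟩ := h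
  obtain ⟨he, hc⟩ := mem_candidates.1 hbest.1
  have hce := (tableInv_table obs T).cicp e he
  obtain ⟨hNE, -, hF, -⟩ := (isCICP_cons_iff hce.head).1 hc
  obtain ⟨s, rfl⟩ := mem_affineSpan_pair_iff_exists_lineMap_eq.1 hA
  have hform : e.vertex - AffineMap.lineMap R.upperLeft e.vertex s =
      (1 - s) • (e.vertex - R.upperLeft) := by
    rw [AffineMap.lineMap_apply_module]; module
  have hs : 0 < 1 - s := by
    have h1 := congrArg (fun z : Point => z 1) hform
    simp only [PiLp.sub_apply, PiLp.smul_apply, smul_eq_mul, hA1] at h1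
    have h2 := hNE.2.1
    have h3 : t < R.upperLeft 1 := by
      have := hb R hR
      have := R.bot_lt_top
      simp [Rect.upperLeft]; linarith
    by_contra hneg
    nlinarith
  refine ⟨_, hce.cons ?_ hfree ?_, by rwa [chainLength_entry he]⟩
  · rw [mem_NE_iff, hform]; exact (mem_NE_iff.1 hNE).smul hs
  · rw [hform]; exact hF.smul hs.le

/-- Slightly to the right of `a` the strict turn persists and the first edge is shorter. Only a
collision can make these points invisible, which puts an upper-left vertex on the first edge. -/
theorem mem_leftEnds (hN : ∀ k, IsNode obs T k → t < k 1) (hb : ∀ R ∈ obs, t < R.bot)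
    {a b : ℝ} (ha : PVisible obs T L (pt t a)) (hab : a < b) (haT : a < T 0)
    (hno : ∀ z, a < z → z < b → ¬ PVisible obs T L (pt t z)) : pt t a ∈ leftEnds obs T L t := by
  have inv := tableInv_table obs T
  obtain ⟨c, hc, hcL⟩ := ha
  obtain ⟨e, he, hs, hturn⟩ := exists_shortest_entry (fun k hk => hN k hk) hc
  have hlen : dist (pt t a) e.vertex + e.len ≤ L := by
    rw [← chainLength_entry he]; exact (hs.2 c hc).trans hcL
  have hce := inv.cicp e he
  have hv1 := hN _ (inv.node e he)
  obtain ⟨hNE, hfree, hF, -⟩ := (isCICP_cons_iff hce.head).1 hs.1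
  -- A convex chain with a vertical first edge stays vertical and could not reach `T`, which is
  -- strictly to the right.
  have hav : a < e.vertex 0 := by
    refine lt_of_le_of_ne hNE.1 fun h => ?_
    have := hs.1.cr_end (mem_NE_iff.1 hNE)
      (show Follows _ (pt t a :: e.chain) by
        obtain ⟨c0, hc0⟩ := hce.exists_eq_cons
        rw [hc0]
        exact (cr_self _).ge)
    simp only [cr, PiLp.sub_apply, pt_zero, pt_one, ← h] at this
    nlinarith
  by_contra hnot
  have hdis : ∀ᶠ x in 𝓝[>] a, ∀ R ∈ {R | R ∈ obs},
      Disjoint (segment ℝ (pt t x) e.vertex) R.inside := by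
    refine (obs.finite_toSet.eventually_all).2 fun R hR =>
      eventually_disjoint_inside hv1 hav (hfree R hR) ?_
    rintro ⟨hu, hlt⟩
    have htu : t < R.upperLeft 1 := by
      have := hb R hR
      have := R.bot_lt_top
      simp [Rect.upperLeft]; linarith
    refine hnot ⟨R, hR, e, hs.isBest he hu hav htu hlt, rfl, ?_, hlen, hfree⟩
    obtain ⟨τ, h0, h1, e1, e2⟩ := cr_sub_of_mem_segment hu
    have hτ1 : 1 - τ ≠ 0 := by
      intro h
      rw [h, zero_smul, sub_eq_zero] at e2
      rw [e2] at hlt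
      exact lt_irrefl _ hlt
    refine mem_affineSpan_pair_iff_exists_lineMap_eq.2 ⟨-(τ / (1 - τ)), ?_⟩
    rw [AffineMap.lineMap_apply, vsub_eq_sub, vadd_eq_add, e2, smul_smul, neg_mul,
      div_mul_cancel₀ _ hτ1, neg_smul, ← e1]
    abel
  have hnear : ∀ᶠ x in 𝓝[>] a, a < x ∧ x < min b (e.vertex 0) :=
    Ioo_mem_nhdsGT (lt_min hab hav)
  obtain ⟨x, hx1, hx2, hx3⟩ := (hdis.and ((eventually_follows hturn).and hnear)).exists
  have hxv := hx3.2.trans_le (min_le_right _ _)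
  refine hno x hx3.1 (hx3.2.trans_le (min_le_left _ _)) ((pVisible_pt_iff hN).2
    ⟨e, he, hce.cons ((mem_NE_pt_iff hv1).2 hxv.le) (fun R hR => hx1 R hR) hx2, ?_⟩)
  have := dist_lt_of_right (p := pt t a) (p' := pt t x) (q := e.vertex) rfl hx3.1 hxv.le
  linarith

/-! ### Correctness -/

/-- An invisible point lies in a gap of the closed set V. The ends of the gap are end-points, and no
end-point is inside because end-points are visible. -/
theorem not_pVisible_iff_mem_interval (hN : ∀ k, IsNode obs T k → t < k 1)
    (hb : ∀ R ∈ obs, t < R.bot) (hl : ∀ R ∈ obs, R.right ≤ T 0) {Q : Point} (hQ : Q 1 = t)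
    (hQT : dist Q T = L) (hQleft : Q 0 ≤ T 0) {Y : Point} (hY1 : Y 1 = t) (hY0 : Q 0 ≤ Y 0)
    (hYT : Y 0 ≤ T 0) :
    ¬ PVisible obs T L Y ↔ ∃ J ∈ intervals obs T Q L t, Y ∈ J := by
  have hT : t < T 1 := hN T (Or.inl rfl)
  have hL : T 1 - t ≤ L := by
    rw [← hQT]
    refine le_of_pow_le_pow_left₀ two_ne_zero dist_nonneg ?_
    rw [dist_sq, hQ]
    nlinarith [sq_nonneg (Q 0 - T 0)]
  set V := {x | PVisible obs T L (pt t x)} with hV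
  have hclosed : IsClosed V := isClosed_visible hN
  have hTV : T 0 ∈ V := pVisible_below_target hl hT hL
  have hendV : ∀ C ∈ ends obs T L t, C 0 ∈ V ∧ C = pt t (C 0) := by
    rintro C (hC | hC)
    · have := eq_pt (leftEnds_height hC)
      exact ⟨by rw [hV, Set.mem_ofPred_eq, ← this]; exact leftEnds_visible hb hC, this⟩
    · have := eq_pt (rightEnds_height hC)
      exact ⟨by rw [hV, Set.mem_ofPred_eq, ← this]; exact rightEnds_visible hC, this⟩
  have hVQ : ∀ x ∈ V, Q 0 ≤ x := fun x hx => PVisible.ge_of_dist_eq hQT hQ.symm hx hQleft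
  have hpred : ∀ a y, a ∈ V → a ≤ y → ∃ a' ∈ V, a ≤ a' ∧ a' ≤ y ∧ ∀ z, a' < z → z ≤ y → z ∉ V := by
    intro a y ha hay
    have hcpt : IsCompact (V ∩ Set.Icc a y) := isCompact_Icc.inter_left hclosed
    obtain ⟨m, ⟨hmV, hm⟩, hmax⟩ := hcpt.exists_isGreatest ⟨a, ha, le_rfl, hay⟩
    exact ⟨m, hmV, hm.1, hm.2, fun z hz hzy hzV =>
      absurd (hmax ⟨hzV, hm.1.trans hz.le, hzy⟩) (not_le.2 hz)⟩
  have hYpt := eq_pt hY1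
  constructor
  · intro hnot
    have hYV : Y 0 ∉ V := by rw [hV, Set.mem_ofPred_eq, ← hYpt]; exact hnot
    have hcpt : IsCompact (V ∩ Set.Icc (Y 0) (T 0)) := isCompact_Icc.inter_left hclosed
    obtain ⟨b, ⟨hbV, hbI⟩, hbmin⟩ := hcpt.exists_isLeast ⟨T 0, hTV, hYT, le_rfl⟩
    have hYb : Y 0 < b := lt_of_le_of_ne hbI.1 fun h => hYV (h ▸ hbV)
    have hgap : ∀ z, Y 0 ≤ z → z < b → z ∉ V := fun z h1 h2 hz =>
      absurd (hbmin ⟨hz, h1, h2.le.trans hbI.2⟩) (not_le.2 h2)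
    have hbR : pt t b ∈ rightEnds obs T L t :=
      mem_rightEnds hN hb hbV hYb fun z h1 h2 => hgap z h1.le h2
    by_cases hex : ∃ a ∈ V, a ≤ Y 0
    · obtain ⟨a₀, ha₀, ha₀Y⟩ := hex
      obtain ⟨a, haV, -, haY, ha⟩ := hpred a₀ (Y 0) ha₀ ha₀Y
      have haY' : a < Y 0 := lt_of_le_of_ne haY fun h => hYV (h ▸ haV)
      have hgap' : ∀ z, a < z → z < b → z ∉ V := by
        intro z h1 h2
        rcases le_total z (Y 0) with h | h
        · exact ha z h1 h
        · exact hgap z h h2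
      refine ⟨openInterval t (pt t a) (pt t b), Or.inl ⟨pt t a,
        mem_leftEnds hN hb haV (haY'.trans hYb) (haY'.trans_le hYT) hgap', pt t b, hbR,
        haY'.trans hYb, ?_, rfl⟩, hY1, haY', hYb⟩
      rintro ⟨C, hC, h1, h2⟩
      exact hgap' _ h1 h2 (hendV C hC).1
    · push Not at hex
      refine ⟨halfOpenInterval t Q (pt t b), Or.inr ⟨pt t b, hbR, ?_, rfl⟩, hY1, hY0, hYb⟩
      rintro ⟨C, hC, h2⟩
      have hCV := (hendV C hC).1
      exact hgap _ (hex _ hCV).le h2 hCV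
  · rintro ⟨J, hJ, hYJ⟩ hvis
    have hYV : Y 0 ∈ V := by rw [hV, Set.mem_ofPred_eq, ← hYpt]; exact hvis
    -- Between a visible `Y` and `B` there is an invisible point. The last visible point before it
    -- is a left end-point, which contradicts the adjacency required in `intervals`.
    have hmain : ∀ B ∈ rightEnds obs T L t, Y 0 < B 0 →
        ∃ C ∈ leftEnds obs T L t, Y 0 ≤ C 0 ∧ C 0 < B 0 := by
      intro B hB hYB
      rw [eq_pt (rightEnds_height hB)] at hB
      obtain ⟨z, hz1, hz2, hz3⟩ := exists_not_visible_left hN hB hYB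
      obtain ⟨a, haV, ha1, ha2, ha3⟩ := hpred (Y 0) z hYV hz1.le
      have haz : a < z := lt_of_le_of_ne ha2 fun h => hz3 (h ▸ haV)
      have hBT : B 0 ≤ T 0 := (rightEnds_visible hB).le_target
      exact ⟨pt t a, mem_leftEnds hN hb haV haz ((haz.trans hz2).trans_le hBT)
        fun w h1 h2 => ha3 w h1 h2.le, ha1, haz.trans hz2⟩
    rcases hJ with ⟨A, -, B, hB, -, hno, rfl⟩ | ⟨B, hB, hno, rfl⟩
    · obtain ⟨C, hC, h1, h2⟩ := hmain B hB hYJ.2.2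
      exact hno ⟨C, Or.inl hC, hYJ.2.1.trans_le h1, h2⟩
    · obtain ⟨C, hC, h1, h2⟩ := hmain B hB hYJ.2.2
      exact hno ⟨C, Or.inl hC, h2⟩

end PVA

theorem theorem1 (h r L : ℝ) (hr : 0 < r) (hh : 2 * r < h) (hL : 0 < L)
    (T : PVA.Point) (hT : h < T 1)
    (obs : List PVA.Rect)
    (habove : ∀ R ∈ obs, h ≤ R.bot)
    (hleft : ∀ R ∈ obs, R.right ≤ T 0)
    (Q : PVA.Point) (hQ : Q 1 = h - r) (hQT : dist Q T = L) (hQleft : Q 0 ≤ T 0) :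
    (∀ Y ∈ segment ℝ Q (PVA.proj T (h - r)),
      (¬ PVA.PVisible obs T L Y ↔ ∃ J ∈ PVA.intervals obs T Q L (h - r), Y ∈ J)) ∧
    PVA.output obs T Q L (h - r) =
      {Y ∈ segment ℝ Q (PVA.proj T (h - r)) | PVA.PVisible obs T L Y} := by
  have hb : ∀ R ∈ obs, h - r < R.bot := fun R hR => by linarith [habove R hR]
  have hN : ∀ k, PVA.IsNode obs T k → h - r < k 1 := by
    rintro k (rfl | ⟨R, hR, rfl⟩)
    · linarith
    · exact hb R hR
  have main : ∀ Y ∈ segment ℝ Q (PVA.proj T (h - r)),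
      (¬ PVA.PVisible obs T L Y ↔ ∃ J ∈ PVA.intervals obs T Q L (h - r), Y ∈ J) := by
    intro Y hY
    obtain ⟨τ, h0, h1, rfl⟩ := PVA.mem_segment_iff.1 hY
    refine PVA.not_pVisible_iff_mem_interval hN hb hleft hQ hQT hQleft ?_ ?_ ?_ <;>
      simp [PVA.proj, hQ] <;> nlinarith
  refine ⟨main, ?_⟩
  ext Y
  simp only [PVA.output, Set.mem_sdiff, Set.mem_sUnion, Set.mem_ofPred_eq]
  refine and_congr_right fun hY => ?_
  rw [← main Y hY, not_not]
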